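/- Fix a real number $q$ with $0<q<\tfrac12$ and a positive integer $n$. Two teams G and B play a match in which the goals are scored one after another, each goal, independently of all the others, by team B with probability $q$ and by team G with probability $1-q$. Phase I lasts until team G has scored its $n$-th goal. If at that moment team B has at least $n$ goals, team B wins immediately and Phase II has duration $0$. Otherwise Phase II starts: the teams keep playing, and team B wins if and only if it ever ties the score; in that case the duration of Phase II is the number of goals scored from the end of Phase I up to and including the first goal that ties the score. Let $V_n(q)$ be the variance of the duration of Phase II, conditional on the event that team B wins (this event has positive probability, and the conditional second moment is finite). Then, for fixed $q$, $$\lim_{n\to\infty} V_n(q)=\frac{(1-q)(2+3q-4q^2)}{(1-2q)^4},$$ and more precisely, as $n\to\infty$, $$ \begin{aligned} V_n(q)={}&\frac{(q-1)(4q^2-3q-2)}{(2q-1)^4}-\frac{(q-1)(4q^2+2q-7)}{(2q-1)^6}\cdot\frac1n\\ &-\frac{(q-1)(24q^4-12q^3-58q^2+29q+18)}{(2q-1)^8}\cdot\frac1{n^2}\\ &-\frac{(q-1)(144q^6-216q^5-348q^4+444q^3+328q^2-312q-41)}{(2q-1)^{10}}\cdot\frac1{n^3}\\ &-\frac{(q-1)(864q^8-2160q^7-1704q^6+4956q^5+4632q^4-9972q^3+1586q^2+1711q+88)}{(2q-1)^{12}}\cdot\frac1{n^4}+O\!\left(\frac1{n^5}\right).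 \end{aligned} $$ -/

import Mathlib

open MeasureTheory ProbabilityTheory Filter Asymptotics
open scoped Topology

namespace SoccerMatch

/-! A *history* is a sequence `x : ℕ → Bool`; `x i = true` means that the goal number `i`
(counted from `0`) is scored by team B, and `x i = false` that it is scored by team G. -/

/-- Number of goals of team B among the first `t` goals of the match. -/
def goalsB (x : ℕ → Bool) (t : ℕ) : ℕ := Nat.count (fun i => x i = true) t

/-- Number of goals of team G among the first `t` goals of the match. -/
def goalsG (x : ℕ → Bool) (t : ℕ) : ℕ := Nat.count (fun i => x i = false) t

/-- Phase I ends: team G scores its `n`-th goal at some time. -/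
def PhaseOneEnds (n : ℕ) (x : ℕ → Bool) : Prop := ∃ t, goalsG x t = n

/-- Total number of goals scored in Phase I, that is, the first time at which team G has `n` goals
(meaningful when `PhaseOneEnds n x`). -/
noncomputable def phaseOneLength (n : ℕ) (x : ℕ → Bool) : ℕ := sInf {t | goalsG x t = n}

/-- After `k` goals of Phase II, team B has at least as many goals (in the whole match)
as team G. -/
def CaughtUpAfter (n : ℕ) (x : ℕ → Bool) (k : ℕ) : Prop :=
  goalsG x (phaseOneLength n x + k) ≤ goalsB x (phaseOneLength n x + k)

/-- Team B wins: Phase I ends, and then team B either already has at least as many goals as team G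
(the case `k = 0`), or ties the score at some later time. -/
def TeamBWins (n : ℕ) (x : ℕ → Bool) : Prop :=
  PhaseOneEnds n x ∧ ∃ k, CaughtUpAfter n x k

/-- Duration of Phase II, in goals: the number of goals scored after the end of Phase I until team B
has caught up; it is `0` if team B is not behind at the end of Phase I
(meaningful when `TeamBWins n x`). -/
noncomputable def phaseTwoDuration (n : ℕ) (x : ℕ → Bool) : ℕ := sInf {k | CaughtUpAfter n x k}

/-- The goals `X 0, X 1, …` are independent, and each is scored by team B (value `true`) with
probability `q`. -/
structure IsMatch {Ω : Type*} [MeasurableSpace Ω] (μ : Measure Ω) (q : ℝ)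
    (X : ℕ → Ω → Bool) : Prop where
  measurable : ∀ i, Measurable (X i)
  indep : iIndepFun X μ
  prob : ∀ i, μ.real {ω | X i ω = true} = q

/-- The event that team B wins the match with parameter `n`. -/
def winEvent {Ω : Type*} (X : ℕ → Ω → Bool) (n : ℕ) : Set Ω :=
  {ω | TeamBWins n (fun i => X i ω)}

/-- The duration of Phase II as a real random variable. -/
noncomputable def duration {Ω : Type*} (X : ℕ → Ω → Bool) (n : ℕ) (ω : Ω) : ℝ :=
  (phaseTwoDuration n (fun i => X i ω) : ℝ)

/-- The variance of the duration of Phase II under the conditional law given that team B wins. -/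
noncomputable def condVarDuration {Ω : Type*} [MeasurableSpace Ω] (μ : Measure Ω)
    (X : ℕ → Ω → Bool) (n : ℕ) : ℝ :=
  variance (duration X n) (ProbabilityTheory.cond μ (winEvent X n))

end SoccerMatch

namespace SoccerMatch

/-! ### Negative binomial weights -/

/-- In a sequence of independent trials with success probability `a` and failure probability `b`,
the probability that the `n`-th success is preceded by exactly `j` failures. -/
noncomputable def negBinTerm (a b : ℝ) (n j : ℕ) : ℝ := ((n - 1 + j).choose j : ℝ) * a ^ n * b ^ j

/-- The probability of `n` successes before the `k`-th failure. -/
noncomputable def raceProb (a b : ℝ) (n k : ℕ) : ℝ := ∑ j ∈ Finset.range k, negBinTerm a b n j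

/-- The moments of the margin `n - j` under the weights `negBinTerm a b n j`, `j < n`. -/
noncomputable def marginMoment (a b : ℝ) (i n : ℕ) : ℝ :=
  ∑ j ∈ Finset.range n, negBinTerm a b n j * ((n : ℝ) - j) ^ i

/-- The probability that both teams have `n` goals after `2 * n` goals, halved. -/
noncomputable def halfTie (q : ℝ) (n : ℕ) : ℝ := (n.centralBinom : ℝ) / 2 * ((1 - q) * q) ^ n

lemma negBinTerm_nonneg {a b : ℝ} (ha : 0 ≤ a) (hb : 0 ≤ b) (n j : ℕ) : 0 ≤ negBinTerm a b n j := by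
  unfold negBinTerm; positivity

lemma negBinTerm_pos {a b : ℝ} (ha : 0 < a) (hb : 0 < b) (n j : ℕ) : 0 < negBinTerm a b n j := by
  unfold negBinTerm
  have : 0 < (n - 1 + j).choose j := Nat.choose_pos (by omega)
  positivity

lemma raceProb_pos {a b : ℝ} (ha : 0 < a) (hb : 0 < b) {n k : ℕ} (hk : 1 ≤ k) :
    0 < raceProb a b n k :=
  Finset.sum_pos (fun j _ => negBinTerm_pos ha hb n j) ⟨0, Finset.mem_range.2 hk⟩

lemma marginMoment_nonneg {a b : ℝ} (ha : 0 ≤ a) (hb : 0 ≤ b) (i n : ℕ) :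
    0 ≤ marginMoment a b i n := by
  refine Finset.sum_nonneg fun j hj => mul_nonneg (negBinTerm_nonneg ha hb n j) (pow_nonneg ?_ i)
  have : (j : ℝ) < n := by exact_mod_cast Finset.mem_range.1 hj
  linarith

lemma raceProb_sub_succ {a b : ℝ} (hab : a + b = 1) {n : ℕ} (hn : 1 ≤ n) (k : ℕ) :
    raceProb a b n k - raceProb a b (n + 1) k = ((n + k - 1).choose n : ℝ) * a ^ n * b ^ k := by
  obtain ⟨m, rfl⟩ : ∃ m, n = m + 1 := ⟨n - 1, by omega⟩
  induction k with
  | zero => simp [raceProb]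
  | succ k ih =>
    have h1 : ((m + 1 + k).choose (m + 1) : ℝ)
        = ((m + k).choose k : ℝ) + ((m + k).choose (m + 1) : ℝ) := by
      have e : m + 1 + k = (m + k) + 1 := by omega
      rw [e, Nat.choose_succ_succ, Nat.choose_symm_add]
      push_cast; ring
    have h2 : ((m + 1 + k).choose k : ℝ) = ((m + 1 + k).choose (m + 1) : ℝ) := by
      rw [Nat.choose_symm_add]
    simp only [raceProb, Finset.sum_range_succ, negBinTerm] at ih ⊢
    simp only [Nat.add_sub_cancel, show m + 1 + (k + 1) - 1 = m + 1 + k by omega,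
      show m + 1 + k - 1 = m + k by omega] at ih ⊢
    obtain rfl : b = 1 - a := by linarith
    rw [h2, h1]
    rw [show ∀ s u s' v : ℝ, s + u - (s' + v) = (s - s') + (u - v) by intros; ring, ih]
    ring

lemma centralBinom_eq_two_mul {n : ℕ} (hn : 1 ≤ n) :
    (n.centralBinom : ℝ) = 2 * ((n + n - 1).choose n : ℝ) := by
  obtain ⟨m, rfl⟩ : ∃ m, n = m + 1 := ⟨n - 1, by omega⟩
  rw [Nat.centralBinom_eq_two_mul_choose, show 2 * (m + 1) = (m + 1 + m) + 1 by ring,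
    Nat.choose_succ_succ, show m + 1 + (m + 1) - 1 = m + 1 + m by omega,
    Nat.choose_symm_add (a := m + 1), Nat.choose_symm_of_eq_add (n := m + 1 + m) (a := m)
      (b := m + 1) (by ring), Nat.choose_symm_add]
  push_cast
  ring

lemma raceProb_succ_succ {a b : ℝ} (hab : a + b = 1) {n : ℕ} (hn : 1 ≤ n) :
    raceProb a b (n + 1) (n + 1) = raceProb a b n n - (b - a) * halfTie a n := by
  have h := raceProb_sub_succ hab hn n
  have h1 : raceProb a b (n + 1) (n + 1)
      = raceProb a b (n + 1) n + (n.centralBinom : ℝ) * a ^ (n + 1) * b ^ n := by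
    rw [raceProb, Finset.sum_range_succ, ← raceProb, negBinTerm, Nat.add_sub_cancel,
      Nat.centralBinom_eq_two_mul_choose, two_mul]
  obtain rfl : b = 1 - a := by linarith
  rw [h1, halfTie, centralBinom_eq_two_mul hn, mul_pow, pow_succ]
  linear_combination -h

lemma halfTie_symm (q : ℝ) (n : ℕ) : halfTie (1 - q) n = halfTie q n := by
  simp [halfTie, mul_comm]

lemma raceProb_add_raceProb (q : ℝ) {n : ℕ} (hn : 1 ≤ n) :
    raceProb q (1 - q) n n + raceProb (1 - q) q n n = 1 := by
  induction n, hn using Nat.le_induction with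
  | base => simp [raceProb, negBinTerm]
  | succ n hn ih =>
    rw [raceProb_succ_succ (by ring) hn, raceProb_succ_succ (by ring) hn, halfTie_symm]
    linear_combination ih

lemma succ_mul_negBinTerm_succ (a b : ℝ) {n : ℕ} (hn : 1 ≤ n) (j : ℕ) :
    ((j : ℝ) + 1) * negBinTerm a b n (j + 1) = b * ((n : ℝ) + j) * negBinTerm a b n j := by
  obtain ⟨m, rfl⟩ : ∃ m, n = m + 1 := ⟨n - 1, by omega⟩
  have h : ((m + (j + 1)).choose (j + 1) : ℝ) * (j + 1) = ((m : ℝ) + 1 + j) * (m + j).choose j := by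
    have := Nat.add_one_mul_choose_eq (m + j) j
    have h' : ((m : ℝ) + j + 1) * ((m + j).choose j : ℝ)
        = ((m + j + 1).choose (j + 1) : ℝ) * (j + 1) := by exact_mod_cast this
    rw [← add_assoc, ← h']; ring
  simp only [negBinTerm, Nat.add_sub_cancel]
  push_cast
  rw [pow_succ b j]
  linear_combination (a ^ (m + 1) * b ^ j * b) * h

/-- Summation by parts for the negative binomial weights. -/
lemma sum_negBinTerm_mul (a b : ℝ) {n : ℕ} (hn : 1 ≤ n) (g : ℕ → ℝ) (k : ℕ) :
    ∑ j ∈ Finset.range k, negBinTerm a b n j * (b * ((n : ℝ) + j) * g (j + 1) - j * g j)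
      = k * g k * negBinTerm a b n k := by
  induction k with
  | zero => simp
  | succ k ih =>
    rw [Finset.sum_range_succ, ih]
    have := succ_mul_negBinTerm_succ a b hn k
    push_cast
    linear_combination (-g (k + 1)) * this

lemma negBinTerm_diag {q : ℝ} {n : ℕ} (hn : 1 ≤ n) : negBinTerm q (1 - q) n n = halfTie q n := by
  rw [negBinTerm, halfTie, centralBinom_eq_two_mul hn, show n - 1 + n = n + n - 1 by omega, mul_pow]
  ring

lemma marginMoment_one_eq (q : ℝ) {n : ℕ} (hn : 1 ≤ n) :
    q * marginMoment q (1 - q) 1 n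
      = n * (halfTie q n - (1 - 2 * q) * raceProb q (1 - q) n n) := by
  have h := sum_negBinTerm_mul q (1 - q) hn (fun _ => 1) n
  rw [negBinTerm_diag hn] at h
  rw [mul_sub, ← mul_one (n : ℝ), ← h, marginMoment, raceProb]
  simp only [Finset.mul_sum, ← Finset.sum_sub_distrib]
  refine Finset.sum_congr rfl fun j _ => ?_
  ring

lemma marginMoment_two_eq (q : ℝ) {n : ℕ} (hn : 1 ≤ n) :
    q * marginMoment q (1 - q) 2 n
      = 2 * (1 - q) * n * raceProb q (1 - q) n n
        - ((1 - q) + n * (1 - 2 * q)) * marginMoment q (1 - q) 1 n := by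
  have h := sum_negBinTerm_mul q (1 - q) hn (fun j => (j : ℝ) - n) n
  rw [sub_self, mul_zero, zero_mul] at h
  rw [← sub_eq_zero, ← neg_eq_zero, ← h, marginMoment, raceProb, marginMoment]
  simp only [Finset.mul_sum, ← Finset.sum_sub_distrib, ← Finset.sum_neg_distrib]
  refine Finset.sum_congr rfl fun j _ => ?_
  push_cast
  ring

lemma raceProb_le_halfTie {q : ℝ} (hq0 : 0 < q) (hq1 : q < 1) {n : ℕ} (hn : 1 ≤ n) :
    (1 - 2 * q) * raceProb q (1 - q) n n ≤ halfTie q n := by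
  have h := marginMoment_one_eq q hn
  have h0 := mul_nonneg hq0.le
    (marginMoment_nonneg hq0.le (by linarith : (0 : ℝ) ≤ 1 - q) 1 n)
  rw [h] at h0
  have hn' : (0 : ℝ) < n := by exact_mod_cast hn
  linarith [nonneg_of_mul_nonneg_right h0 hn']

lemma halfTie_pos {q : ℝ} (hq0 : 0 < q) (hq1 : q < 1) (n : ℕ) : 0 < halfTie q n := by
  have h1 : (0 : ℝ) < n.centralBinom := by exact_mod_cast n.centralBinom_pos
  have h2 : 0 < 1 - q := by linarith
  unfold halfTie; positivity

lemma halfTie_succ (q : ℝ) (n : ℕ) :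
    ((n : ℝ) + 1) * halfTie q (n + 1) = 2 * (1 - q) * q * (2 * n + 1) * halfTie q n := by
  have h : ((n : ℝ) + 1) * ((n + 1).centralBinom : ℝ) = 2 * (2 * n + 1) * n.centralBinom := by
    exact_mod_cast Nat.succ_mul_centralBinom_succ n
  rw [halfTie, halfTie, pow_succ]
  linear_combination (((1 - q) * q) ^ n * ((1 - q) * q) / 2) * h

lemma tendsto_halfTie {q : ℝ} (hq0 : 0 < q) (hq1 : q < 1 / 2) :
    Tendsto (halfTie q) atTop (𝓝 0) := by
  have hle : ∀ n, halfTie q n ≤ (4 * ((1 - q) * q)) ^ n := by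
    intro n
    induction n with
    | zero => norm_num [halfTie]
    | succ n ih =>
      have h := halfTie_succ q n
      have hp := halfTie_pos hq0 (by linarith : q < 1) n
      have hn : (0 : ℝ) < (n : ℝ) + 1 := by positivity
      have hpq : 0 < (1 - q) * q := mul_pos (by linarith) hq0
      have : halfTie q (n + 1) ≤ 4 * ((1 - q) * q) * halfTie q n := by
        refine le_of_mul_le_mul_left ?_ hn
        rw [h]
        nlinarith [mul_pos hpq hp]
      calc halfTie q (n + 1) ≤ 4 * ((1 - q) * q) * halfTie q n := this
        _ ≤ 4 * ((1 - q) * q) * (4 * ((1 - q) * q)) ^ n := by gcongr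
        _ = _ := by ring
  refine squeeze_zero (fun n => (halfTie_pos hq0 (by linarith) n).le) hle
    (tendsto_pow_atTop_nhds_zero_of_lt_one ?_ ?_)
  · nlinarith
  · nlinarith

/-! ### An enveloping inverse factorial series for the tail probability -/

/-- The terms of the inverse factorial series of `(1 - 2 * q) * raceProb / halfTie`. -/
noncomputable def factorialTerm (z : ℝ) (n i : ℕ) : ℝ :=
  ∏ j ∈ Finset.range i, (-z * (2 * j + 1) / ((n : ℝ) + j + 1))

/-- Partial sums of the inverse factorial series. -/
noncomputable def factorialSum (z : ℝ) (n k : ℕ) : ℝ := ∑ i ∈ Finset.range k, factorialTerm z n i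

lemma factorialTerm_succ (z : ℝ) (n i : ℕ) :
    factorialTerm z n (i + 1) = factorialTerm z n i * (-z * (2 * i + 1) / ((n : ℝ) + i + 1)) :=
  Finset.prod_range_succ _ _

lemma factorialTerm_shift (z : ℝ) (n i : ℕ) :
    ((n : ℝ) + 1 + i) * factorialTerm z (n + 1) i = ((n : ℝ) + 1) * factorialTerm z n i := by
  induction i with
  | zero => simp [factorialTerm]
  | succ i ih =>
    have h1 : (n : ℝ) + i + 1 ≠ 0 := by positivity
    have h2 : (n : ℝ) + 1 + i + 1 ≠ 0 := by positivity
    rw [factorialTerm_succ, factorialTerm_succ]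
    have ih' : factorialTerm z (n + 1) i
        = ((n : ℝ) + 1) * factorialTerm z n i / ((n : ℝ) + i + 1) := by
      rw [eq_div_iff h1, ← ih]; ring
    rw [ih']
    push_cast
    field_simp
    ring

lemma factorialTerm_mul_halfTie_sub {q z : ℝ} (hz : z * (1 - 2 * q) ^ 2 = 2 * (1 - q) * q)
    (n i : ℕ) :
    factorialTerm z n i * halfTie q n - factorialTerm z (n + 1) i * halfTie q (n + 1)
      = (1 - 2 * q) ^ 2 * halfTie q n * (factorialTerm z n i - factorialTerm z n (i + 1)) := by
  have h1 : (n : ℝ) + i + 1 ≠ 0 := by positivity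
  have h2 : (n : ℝ) + 1 ≠ 0 := by positivity
  have e1 : halfTie q (n + 1) = 2 * (1 - q) * q * (2 * n + 1) * halfTie q n / ((n : ℝ) + 1) := by
    rw [eq_div_iff h2, ← halfTie_succ]; ring
  have e2 : factorialTerm z (n + 1) i
      = ((n : ℝ) + 1) * factorialTerm z n i / ((n : ℝ) + i + 1) := by
    rw [eq_div_iff h1, ← factorialTerm_shift]; ring
  rw [e1, e2, factorialTerm_succ, ← hz]
  field_simp
  linear_combination (-2 * ((n : ℝ) + i + 1) * factorialTerm z n i * halfTie q n) * hz

lemma factorialSum_mul_halfTie_sub {q z : ℝ} (hz : z * (1 - 2 * q) ^ 2 = 2 * (1 - q) * q)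
    (n k : ℕ) :
    factorialSum z n k * halfTie q n - factorialSum z (n + 1) k * halfTie q (n + 1)
      = (1 - 2 * q) ^ 2 * halfTie q n * (1 - factorialTerm z n k) := by
  have h0 : factorialTerm z n 0 = 1 := by simp [factorialTerm]
  rw [factorialSum, factorialSum, Finset.sum_mul, Finset.sum_mul, ← Finset.sum_sub_distrib,
    ← h0, ← Finset.sum_range_sub', Finset.mul_sum]
  exact Finset.sum_congr rfl fun i _ => factorialTerm_mul_halfTie_sub hz n i

lemma abs_factorialTerm_le (z : ℝ) (n i : ℕ) :
    |factorialTerm z n i| ≤ ∏ j ∈ Finset.range i, (|z| * (2 * j + 1)) := by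
  rw [factorialTerm, Finset.abs_prod]
  refine Finset.prod_le_prod (fun j _ => abs_nonneg _) fun j _ => ?_
  rw [abs_div, abs_mul, abs_neg, abs_of_nonneg (by positivity : (0 : ℝ) ≤ 2 * j + 1),
    abs_of_nonneg (by positivity : (0 : ℝ) ≤ (n : ℝ) + j + 1)]
  exact div_le_self (by positivity) (by linarith [n.cast_nonneg (α := ℝ), j.cast_nonneg (α := ℝ)])

/-- The signed error of the inverse factorial series, normalised. -/
noncomputable def factorialError (q z : ℝ) (k n : ℕ) : ℝ :=
  factorialSum z n k * halfTie q n - (1 - 2 * q) * raceProb q (1 - q) n n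

lemma factorialError_sub_succ {q z : ℝ} (hz : z * (1 - 2 * q) ^ 2 = 2 * (1 - q) * q) (k : ℕ)
    {n : ℕ} (hn : 1 ≤ n) :
    factorialError q z k n - factorialError q z k (n + 1)
      = -((1 - 2 * q) ^ 2 * halfTie q n * factorialTerm z n k) := by
  have h1 := factorialSum_mul_halfTie_sub hz n k
  have h2 := raceProb_succ_succ (a := q) (b := 1 - q) (by ring) hn
  rw [factorialError, factorialError, h2]
  linear_combination h1

lemma tendsto_factorialError {q : ℝ} (hq0 : 0 < q) (hq1 : q < 1 / 2) (z : ℝ) (k : ℕ) :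
    Tendsto (factorialError q z k) atTop (𝓝 0) := by
  have ha := tendsto_halfTie hq0 hq1
  have h1 : Tendsto (fun n => factorialSum z n k * halfTie q n) atTop (𝓝 0) := by
    refine squeeze_zero_norm (a := fun n =>
      (∑ i ∈ Finset.range k, ∏ j ∈ Finset.range i, (|z| * (2 * j + 1))) * halfTie q n)
      (fun n => ?_) (by simpa using ha.const_mul _)
    rw [Real.norm_eq_abs, abs_mul, abs_of_pos (halfTie_pos hq0 (by linarith) n)]
    refine mul_le_mul_of_nonneg_right ?_ (halfTie_pos hq0 (by linarith) n).le
    exact (Finset.abs_sum_le_sum_abs _ _).trans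
      (Finset.sum_le_sum fun i _ => abs_factorialTerm_le z n i)
  have h2 : Tendsto (fun n => (1 - 2 * q) * raceProb q (1 - q) n n) atTop (𝓝 0) := by
    refine squeeze_zero' ?_ ?_ ha
    · filter_upwards [eventually_ge_atTop 1] with n hn
      exact mul_nonneg (by linarith) (raceProb_pos hq0 (by linarith) hn).le
    · filter_upwards [eventually_ge_atTop 1] with n hn
      exact raceProb_le_halfTie hq0 (by linarith) hn
  have h := h1.sub h2
  rw [sub_zero] at h
  exact h

lemma nonneg_of_antitone_tendsto_zero {u : ℕ → ℝ} {m : ℕ} (h : ∀ n, m ≤ n → u (n + 1) ≤ u n)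
    (hu : Tendsto u atTop (𝓝 0)) : ∀ n, m ≤ n → 0 ≤ u n := by
  intro n hn
  refine le_of_tendsto hu ?_
  filter_upwards [eventually_ge_atTop n] with k hk
  induction k, hk using Nat.le_induction with
  | base => exact le_rfl
  | succ k hk ih => exact (h k (hn.trans hk)).trans ih

lemma neg_one_pow_mul_factorialTerm_nonneg {z : ℝ} (hz : 0 ≤ z) (n i : ℕ) :
    0 ≤ (-1) ^ i * factorialTerm z n i := by
  rw [factorialTerm, ← Finset.card_range i, ← Finset.prod_const, Finset.card_range,
    ← Finset.prod_mul_distrib]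
  refine Finset.prod_nonneg fun j _ => ?_
  rw [show (-1) * (-z * (2 * j + 1) / ((n : ℝ) + j + 1)) = z * (2 * j + 1) / ((n : ℝ) + j + 1) by
    ring]
  positivity

/-- The inverse factorial series is enveloping: the error has the sign opposite to that of the
first omitted term. -/
lemma neg_one_pow_mul_factorialError_nonpos {q z : ℝ} (hq0 : 0 < q) (hq1 : q < 1 / 2)
    (hz : z * (1 - 2 * q) ^ 2 = 2 * (1 - q) * q) (hz0 : 0 ≤ z) (k : ℕ) {n : ℕ} (hn : 1 ≤ n) :
    (-1) ^ k * factorialError q z k n ≤ 0 := by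
  have h := nonneg_of_antitone_tendsto_zero (u := fun n => -((-1) ^ k * factorialError q z k n))
    (m := 1) (fun n hn => ?_) (by simpa using ((tendsto_factorialError hq0 hq1 z k).const_mul
      ((-1) ^ k)).neg) n hn
  · linarith
  · have h1 := factorialError_sub_succ hz k hn
    have h2 := mul_nonneg (mul_nonneg (sq_nonneg (1 - 2 * q))
      (halfTie_pos hq0 (by linarith) n).le) (neg_one_pow_mul_factorialTerm_nonneg hz0 n k)
    have h3 : (-1) ^ k * factorialError q z k n - (-1) ^ k * factorialError q z k (n + 1)
        = -((1 - 2 * q) ^ 2 * halfTie q n * ((-1) ^ k * factorialTerm z n k)) := by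
      linear_combination (-1) ^ k * h1
    show -((-1) ^ k * factorialError q z k (n + 1)) ≤ -((-1) ^ k * factorialError q z k n)
    linarith

lemma abs_factorialError_le {q z : ℝ} (hq0 : 0 < q) (hq1 : q < 1 / 2)
    (hz : z * (1 - 2 * q) ^ 2 = 2 * (1 - q) * q) (hz0 : 0 ≤ z) (k : ℕ) {n : ℕ} (hn : 1 ≤ n) :
    |factorialError q z k n| ≤ |factorialTerm z n k| * halfTie q n := by
  have h1 := neg_one_pow_mul_factorialError_nonpos hq0 hq1 hz hz0 k hn
  have h2 := neg_one_pow_mul_factorialError_nonpos hq0 hq1 hz hz0 (k + 1) hn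
  have h3 : factorialError q z (k + 1) n
      = factorialError q z k n + factorialTerm z n k * halfTie q n := by
    rw [factorialError, factorialError, factorialSum, Finset.sum_range_succ, ← factorialSum]
    ring
  have ha := (halfTie_pos hq0 (by linarith : q < 1) n).le
  have e1 : |factorialError q z k n| = -((-1) ^ k * factorialError q z k n) := by
    rw [← abs_of_nonpos h1, abs_mul, abs_pow, abs_neg, abs_one, one_pow, one_mul]
  have e2 : |factorialTerm z n k| = (-1) ^ k * factorialTerm z n k := by
    rw [← abs_of_nonneg (neg_one_pow_mul_factorialTerm_nonneg hz0 n k), abs_mul, abs_pow, abs_neg,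
      abs_one, one_pow, one_mul]
  rw [e1, e2]
  rw [h3, pow_succ] at h2
  linarith

/-! ### Asymptotic expansion of the mean margin -/

/-- Coefficients of the expansion in powers of `1 / n` of the mean margin, normalised to have
leading coefficient `1`. -/
noncomputable def marginCoeff (z : ℝ) : ℕ → ℝ
  | 0 => 1
  | 1 => -1 - 2 * z
  | 2 => 1 + 7 * z + 10 * z ^ 2
  | 3 => -1 - 18 * z - 69 * z ^ 2 - 74 * z ^ 3
  | 4 => 1 + 41 * z + 315 * z ^ 2 + 827 * z ^ 3 + 706 * z ^ 4
  | 5 => -1 - 88 * z - 1204 * z ^ 2 - 5792 * z ^ 3 - 11537 * z ^ 4 - 8162 * z ^ 5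
  | _ => 0

/-- The expansion of the normalised mean margin, up to order five. -/
noncomputable def marginExpansion (z h : ℝ) : ℝ :=
  ∑ i ∈ Finset.range 6, marginCoeff z i * h ^ i

/-- The remainder in `one_add_mul_marginExpansion_mul`. -/
noncomputable def inversionRemainder (z h : ℝ) : ℝ :=
  (-z - 183 * z ^ 2 - 4188 * z ^ 3 - 32800 * z ^ 4 - 114201 * z ^ 5 - 183015 * z ^ 6 + 24725 * z
  ^ 7) + (-20 * z - 3468 * z ^ 2 - 73974 * z ^ 3 - 519650 * z ^ 4 - 1473300 * z ^ 5 - 1301856 *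
  z ^ 6 + 169633 * z ^ 7 - 73086 * z ^ 8) * h ^ 1 + (-155 * z - 24909 * z ^ 2 - 483927 * z ^ 3 -
  2977775 * z ^ 4 - 6848775 * z ^ 5 - 4707153 * z ^ 6 + 849694 * z ^ 7 - 343908 * z ^ 8 + 370440
  * z ^ 9) * h ^ 2 + (-580 * z - 83292 * z ^ 2 - 1428531 * z ^ 3 - 7589395 * z ^ 4 - 15118020 *
  z ^ 5 - 8568264 * z ^ 6 + 1931012 * z ^ 7 - 1081299 * z ^ 8 + 361305 * z ^ 9 - 2293410 * z ^
  10) * h ^ 3 + (-1044 * z - 125388 * z ^ 2 - 1834650 * z ^ 3 - 8638170 * z ^ 4 - 15260769 * z ^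
  5 - 7118667 * z ^ 6 + 1849881 * z ^ 7 - 1145727 * z ^ 8 + 2017260 * z ^ 9 + 6069000 * z ^ 10 +
  15051960 * z ^ 11) * h ^ 4 + (-720 * z - 62640 * z ^ 2 - 804600 * z ^ 3 - 3396600 * z ^ 4 -
  5281470 * z ^ 5 - 1929690 * z ^ 6 + 538245 * z ^ 7 - 381240 * z ^ 8 - 1324890 * z ^ 9 -
  20503350 * z ^ 10 - 73648575 * z ^ 11 - 84843990 * z ^ 12) * h ^ 5

lemma one_add_mul_marginExpansion_mul (z h : ℝ) :
    (1 * (1 + 1 * h) * (1 + 2 * h) * (1 + 3 * h) * (1 + 4 * h) * (1 + 5 * h) * (1 + 6 * h) - 1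
      * (z * h) ^ 1 * (1 + 2 * h) * (1 + 3 * h) * (1 + 4 * h) * (1 + 5 * h) * (1 + 6 * h) + 3 *
      (z * h) ^ 2 * (1 + 3 * h) * (1 + 4 * h) * (1 + 5 * h) * (1 + 6 * h) - 15 * (z * h) ^ 3 *
      (1 + 4 * h) * (1 + 5 * h) * (1 + 6 * h) + 105 * (z * h) ^ 4 * (1 + 5 * h) * (1 + 6 * h) -
      945 * (z * h) ^ 5 * (1 + 6 * h) + 10395 * (z * h) ^ 6)
      * (1 + z * h * marginExpansion z h)
    = (1 + h) * (1 + 2 * h) * (1 + 3 * h) * (1 + 4 * h) * (1 + 5 * h) * (1 + 6 * h)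
      + h ^ 7 * inversionRemainder z h := by
  simp only [marginExpansion, marginCoeff, Finset.sum_range_succ, Finset.sum_range_zero,
    inversionRemainder]
  ring

lemma factorialSum_seven (z : ℝ) {n : ℕ} (hn : 1 ≤ n) {h : ℝ} (hh : h = 1 / (n : ℝ)) :
    factorialSum z n 7
      * ((1 + h) * (1 + 2 * h) * (1 + 3 * h) * (1 + 4 * h) * (1 + 5 * h) * (1 + 6 * h))
    = 1 * (1 + 1 * h) * (1 + 2 * h) * (1 + 3 * h) * (1 + 4 * h) * (1 + 5 * h) * (1 + 6 * h) - 1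
      * (z * h) ^ 1 * (1 + 2 * h) * (1 + 3 * h) * (1 + 4 * h) * (1 + 5 * h) * (1 + 6 * h) + 3 *
      (z * h) ^ 2 * (1 + 3 * h) * (1 + 4 * h) * (1 + 5 * h) * (1 + 6 * h) - 15 * (z * h) ^ 3 *
      (1 + 4 * h) * (1 + 5 * h) * (1 + 6 * h) + 105 * (z * h) ^ 4 * (1 + 5 * h) * (1 + 6 * h) -
      945 * (z * h) ^ 5 * (1 + 6 * h) + 10395 * (z * h) ^ 6 := by
  have hn' : (0 : ℝ) < n := by exact_mod_cast hn
  have e : ∀ j : ℕ, -z * (2 * (j : ℝ) + 1) / ((n : ℝ) + j + 1)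
      = -(z * h) * (2 * (j : ℝ) + 1) / (1 + (j + 1) * h) := by
    intro j
    have h1 : (n : ℝ) + j + 1 ≠ 0 := by positivity
    have h2 : 1 + ((j : ℝ) + 1) * h ≠ 0 := by rw [hh]; positivity
    rw [div_eq_div_iff h1 h2, hh]
    field_simp
    ring
  have hp : 0 < h := by rw [hh]; positivity
  simp only [factorialSum, factorialTerm, e, Finset.sum_range_succ, Finset.prod_range_succ,
    Finset.sum_range_zero, Finset.prod_range_zero]
  norm_num
  generalize z * h = w
  field_simp
  ring

lemma isBigO_one_of_continuousAt {f : ℝ → ℝ} (hf : ContinuousAt f 0) :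
    (fun n : ℕ => f (1 / (n : ℝ))) =O[atTop] (fun _ => (1 : ℝ)) :=
  (hf.tendsto.comp tendsto_one_div_atTop_nhds_zero_nat).isBigO_one ℝ

lemma abs_factorialTerm_le_pow (z : ℝ) {n : ℕ} (hn : 1 ≤ n) (i : ℕ) :
    |factorialTerm z n i| ≤ (∏ j ∈ Finset.range i, (|z| * (2 * j + 1))) * (1 / (n : ℝ)) ^ i := by
  have hn' : (0 : ℝ) < n := by exact_mod_cast hn
  rw [factorialTerm, Finset.abs_prod]
  conv_rhs => rw [← Finset.card_range i, ← Finset.prod_const, Finset.card_range,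
    ← Finset.prod_mul_distrib]
  refine Finset.prod_le_prod (fun j _ => abs_nonneg _) fun j _ => ?_
  rw [abs_div, abs_mul, abs_neg, abs_of_nonneg (by positivity : (0 : ℝ) ≤ 2 * j + 1),
    abs_of_nonneg (by positivity : (0 : ℝ) ≤ (n : ℝ) + j + 1), mul_one_div]
  gcongr
  linarith [j.cast_nonneg (α := ℝ)]

lemma halfTie_div_isBigO {q z : ℝ} (hq0 : 0 < q) (hq1 : q < 1 / 2)
    (hz : z * (1 - 2 * q) ^ 2 = 2 * (1 - q) * q) (hz0 : 0 ≤ z) :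
    (fun n : ℕ => halfTie q n / ((1 - 2 * q) * raceProb q (1 - q) n n))
      =O[atTop] (fun _ => (1 : ℝ)) := by
  refine IsBigO.of_bound 2 ?_
  obtain ⟨N, hN⟩ := exists_nat_ge (2 * z)
  filter_upwards [eventually_ge_atTop (max 1 N)] with n hn
  have hn1 : 1 ≤ n := (le_max_left _ _).trans hn
  have hnN : 2 * z ≤ n := hN.trans (by exact_mod_cast (le_max_right _ _).trans hn)
  have ha := halfTie_pos hq0 (by linarith : q < 1) n
  have hR := mul_pos (by linarith : 0 < 1 - 2 * q)
    (raceProb_pos hq0 (by linarith : 0 < 1 - q) (n := n) hn1)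
  have h := abs_factorialError_le hq0 hq1 hz hz0 1 hn1
  have e1 : |factorialTerm z n 1| ≤ 1 / 2 := by
    have hn' : (0 : ℝ) < n := by exact_mod_cast hn1
    refine (abs_factorialTerm_le_pow z hn1 1).trans ?_
    simp only [Finset.prod_range_one, pow_one, abs_of_nonneg hz0]
    norm_num
    rw [← div_eq_mul_inv, div_le_iff₀ hn']
    linarith
  have e2 : factorialError q z 1 n
      = halfTie q n - (1 - 2 * q) * raceProb q (1 - q) n n := by
    simp [factorialError, factorialSum, factorialTerm]
  rw [e2] at h
  have h' := (le_abs_self _).trans (h.trans (mul_le_mul_of_nonneg_right e1 ha.le))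
  rw [Real.norm_of_nonneg (div_pos ha hR).le, div_le_iff₀ hR]
  norm_num
  linarith

/-- The mean of the margin `n - j`, divided by its limit `2 * (1 - q) / (1 - 2 * q)`. -/
noncomputable def normMargin (q : ℝ) (n : ℕ) : ℝ :=
  (1 - 2 * q) * marginMoment q (1 - q) 1 n / (2 * (1 - q) * raceProb q (1 - q) n n)

lemma normMargin_sub_expansion_isBigO {q z : ℝ} (hq0 : 0 < q) (hq1 : q < 1 / 2)
    (hz : z * (1 - 2 * q) ^ 2 = 2 * (1 - q) * q) (hz0 : 0 < z) :
    (fun n : ℕ => normMargin q n - marginExpansion z (1 / n))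
      =O[atTop] (fun n : ℕ => 1 / (n : ℝ) ^ 6) := by
  set den : ℝ → ℝ := fun h =>
    (1 + h) * (1 + 2 * h) * (1 + 3 * h) * (1 + 4 * h) * (1 + 5 * h) * (1 + 6 * h) with hden
  have hexp : Continuous (marginExpansion z) := by unfold marginExpansion; fun_prop
  have hrem : Continuous (inversionRemainder z) := by unfold inversionRemainder; fun_prop
  have key : ∀ᶠ n : ℕ in atTop, normMargin q n - marginExpansion z (1 / n)
      = (n / z) * ((halfTie q n / ((1 - 2 * q) * raceProb q (1 - q) n n))
        * ((factorialError q z 7 n / halfTie q n) * (1 + z * (1 / n) * marginExpansion z (1 / n))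
          - (1 / (n : ℝ)) ^ 7 * (inversionRemainder z (1 / n) / den (1 / n)))) := by
    filter_upwards [eventually_ge_atTop 1] with n hn
    have hn' : (0 : ℝ) < n := by exact_mod_cast hn
    have ha := halfTie_pos hq0 (by linarith : q < 1) n
    have hT := raceProb_pos hq0 (by linarith : 0 < 1 - q) (n := n) hn
    have hd : 0 < 1 - 2 * q := by linarith
    have hp : 0 < 1 - q := by linarith
    have hS := marginMoment_one_eq q hn
    have h1 := factorialSum_seven z hn rfl
    have h2 := one_add_mul_marginExpansion_mul z (1 / n)
    rw [← h1] at h2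
    have herr : factorialError q z 7 n = factorialSum z n 7 * halfTie q n
      - (1 - 2 * q) * raceProb q (1 - q) n n := rfl
    have hdpos : 0 < den (1 / n) := by simp only [hden]; positivity
    change factorialSum z n 7 * den (1 / n) * _ = den (1 / n) + _ at h2
    have hS' : normMargin q n
        = n / z * (halfTie q n / ((1 - 2 * q) * raceProb q (1 - q) n n) - 1) := by
      have : marginMoment q (1 - q) 1 n
          = n * (halfTie q n - (1 - 2 * q) * raceProb q (1 - q) n n) / q := by
        rw [eq_div_iff hq0.ne', ← hS]; ring
      have hz' : z = 2 * (1 - q) * q / (1 - 2 * q) ^ 2 := by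
        rw [eq_div_iff (by positivity), hz]
      rw [normMargin, this, hz']
      field_simp
    have h3 : (1 / (n : ℝ)) ^ 7 * (inversionRemainder z (1 / n) / den (1 / n))
        = factorialSum z n 7 * (1 + z * (1 / n) * marginExpansion z (1 / n)) - 1 := by
      rw [← mul_div_assoc, div_eq_iff hdpos.ne']
      linear_combination -h2
    rw [h3, hS', herr]
    generalize marginExpansion z (1 / n) = y
    generalize factorialSum z n 7 = A at *
    field_simp
    ring
  refine EventuallyEq.trans_isBigO key ?_
  have hA := halfTie_div_isBigO hq0 hq1 hz hz0.le
  have hB : (fun n : ℕ => factorialError q z 7 n / halfTie q n)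
      =O[atTop] (fun n : ℕ => (1 / (n : ℝ)) ^ 7) := by
    refine IsBigO.of_bound (∏ j ∈ Finset.range 7, (|z| * (2 * j + 1))) ?_
    filter_upwards [eventually_ge_atTop 1] with n hn
    have ha := halfTie_pos hq0 (by linarith : q < 1) n
    rw [Real.norm_eq_abs, Real.norm_of_nonneg (by positivity), abs_div, abs_of_pos ha,
      div_le_iff₀ ha]
    exact (abs_factorialError_le hq0 hq1 hz hz0.le 7 hn).trans
      (mul_le_mul_of_nonneg_right (abs_factorialTerm_le_pow z hn 7) ha.le)
  have hC : (fun n : ℕ => 1 + z * (1 / (n : ℝ)) * marginExpansion z (1 / n))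
      =O[atTop] (fun _ => (1 : ℝ)) :=
    isBigO_one_of_continuousAt (f := fun h => 1 + z * h * marginExpansion z h)
      (Continuous.continuousAt (by fun_prop))
  have hD : (fun n : ℕ => inversionRemainder z (1 / n) / den (1 / n))
      =O[atTop] (fun _ => (1 : ℝ)) := by
    refine isBigO_one_of_continuousAt (f := fun h => inversionRemainder z h / den h)
      (ContinuousAt.div hrem.continuousAt ?_ ?_)
    · exact Continuous.continuousAt (by simp only [hden]; fun_prop)
    · simp [hden]
  have hE := ((hB.mul hC).sub
    (((isBigO_refl (fun n : ℕ => (1 / (n : ℝ)) ^ 7) atTop).mul hD)))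
  have hF : (fun n : ℕ => (n : ℝ) / z) =O[atTop] (fun n : ℕ => (n : ℝ)) := by
    simp only [div_eq_mul_inv, mul_comm _ z⁻¹]
    exact isBigO_const_mul_self _ _ _
  refine (hF.mul (hA.mul hE)).congr' EventuallyEq.rfl ?_
  filter_upwards [eventually_ge_atTop 1] with n hn
  have hn' : (n : ℝ) ≠ 0 := by positivity
  field_simp

/-- The conditional variance of the duration of Phase II in terms of the moments of the margin. -/
noncomputable def varianceFormula (q : ℝ) (n : ℕ) : ℝ :=
  (marginMoment q (1 - q) 2 n / (1 - 2 * q) ^ 2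
      + 4 * (1 - q) * q / (1 - 2 * q) ^ 3 * marginMoment q (1 - q) 1 n)
    / (2 * raceProb q (1 - q) n n)
  - (marginMoment q (1 - q) 1 n / (1 - 2 * q) / (2 * raceProb q (1 - q) n n)) ^ 2

/-- `varianceFormula` as a function of `y = normMargin q n` and of `n`. -/
noncomputable def varianceOfMargin (q y n : ℝ) : ℝ :=
  (1 - q) / (q * (1 - 2 * q) ^ 2) * ((1 - y) * n - (1 - q) / (1 - 2 * q) * y)
    + 4 * (1 - q) ^ 2 * q / (1 - 2 * q) ^ 4 * y - (1 - q) ^ 2 / (1 - 2 * q) ^ 4 * y ^ 2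

lemma varianceFormula_eq {q : ℝ} (hq0 : 0 < q) (hq1 : q < 1 / 2) {n : ℕ} (hn : 1 ≤ n) :
    varianceFormula q n = varianceOfMargin q (normMargin q n) n := by
  have hT := raceProb_pos hq0 (by linarith : 0 < 1 - q) (n := n) hn
  have hd : 0 < 1 - 2 * q := by linarith
  have hp : 0 < 1 - q := by linarith
  have h2 : marginMoment q (1 - q) 2 n = (2 * (1 - q) * n * raceProb q (1 - q) n n
        - ((1 - q) + n * (1 - 2 * q)) * marginMoment q (1 - q) 1 n) / q := by
    rw [eq_div_iff hq0.ne', ← marginMoment_two_eq q hn]; ring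
  rw [varianceFormula, varianceOfMargin, normMargin, h2]
  field_simp
  ring

/-- The expansion of the conditional variance. -/
noncomputable def varianceExpansion (q n : ℝ) : ℝ :=
  (q - 1) * (4 * q ^ 2 - 3 * q - 2) / (2 * q - 1) ^ 4
    - (q - 1) * (4 * q ^ 2 + 2 * q - 7) / (2 * q - 1) ^ 6 * (1 / n)
    - (q - 1) * (24 * q ^ 4 - 12 * q ^ 3 - 58 * q ^ 2 + 29 * q + 18) / (2 * q - 1) ^ 8
        * (1 / n ^ 2)
    - (q - 1) * (144 * q ^ 6 - 216 * q ^ 5 - 348 * q ^ 4 + 444 * q ^ 3 + 328 * q ^ 2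
          - 312 * q - 41) / (2 * q - 1) ^ 10
        * (1 / n ^ 3)
    - (q - 1) * (864 * q ^ 8 - 2160 * q ^ 7 - 1704 * q ^ 6 + 4956 * q ^ 5 + 4632 * q ^ 4
          - 9972 * q ^ 3 + 1586 * q ^ 2 + 1711 * q + 88) / (2 * q - 1) ^ 12
        * (1 / n ^ 4)

/-- The coefficient of `h ^ k` in `varianceOfMargin q (∑ i, y i * h ^ i) (1 / h)`. -/
noncomputable def varianceCoeff (q : ℝ) (y : ℕ → ℝ) (k : ℕ) : ℝ :=
  (1 - q) / (q * (1 - 2 * q) ^ 2) * (-y (k + 1) - (1 - q) / (1 - 2 * q) * y k)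
    + 4 * (1 - q) ^ 2 * q / (1 - 2 * q) ^ 4 * y k
    - (1 - q) ^ 2 / (1 - 2 * q) ^ 4 * ∑ i ∈ Finset.range (k + 1), y i * y (k - i)

lemma varianceOfMargin_marginExpansion (q z : ℝ) {n : ℝ} (hn : n ≠ 0) :
    varianceOfMargin q (marginExpansion z (1 / n)) n
      = (∑ k ∈ Finset.range 11, varianceCoeff q (marginCoeff z) k * (1 / n) ^ k) := by
  obtain ⟨h, rfl⟩ : ∃ h, n = 1 / h := ⟨1 / n, by simp⟩
  have hh : h ≠ 0 := by rintro rfl; simp at hn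
  have h0 : marginCoeff z 0 = 1 := rfl
  have hz : ∀ k, marginCoeff z (k + 6) = 0 := fun _ => rfl
  rw [one_div_one_div, varianceOfMargin, marginExpansion]
  generalize marginCoeff z = y at *
  have h6 := hz 0
  have h7 := hz 1
  have h8 := hz 2
  have h9 := hz 3
  have h10 := hz 4
  have h11 := hz 5
  norm_num at h6 h7 h8 h9 h10 h11
  have e : (1 - ∑ i ∈ Finset.range 6, y i * h ^ i) * (1 / h)
      = -(y 1 + y 2 * h + y 3 * h ^ 2 + y 4 * h ^ 3 + y 5 * h ^ 4) := by
    simp only [Finset.sum_range_succ, Finset.sum_range_zero, h0]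
    field_simp
    ring
  rw [e]
  simp only [Finset.sum_range_succ, Finset.sum_range_zero, varianceCoeff]
  norm_num [h6, h7, h8, h9, h10, h11]
  ring

lemma varianceOfMargin_sub_expansion {q z n : ℝ} (hq0 : 0 < q) (hq1 : q < 1 / 2)
    (hz : z = 2 * (1 - q) * q / (1 - 2 * q) ^ 2) (hn : n ≠ 0) :
    varianceOfMargin q (marginExpansion z (1 / n)) n - varianceExpansion q n
      = (1 / n) ^ 5 * ∑ k ∈ Finset.range 6,
          varianceCoeff q (marginCoeff z) (k + 5) * (1 / n) ^ k := by
  have hd : 1 - 2 * q ≠ 0 := by linarith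
  have hd' : 2 * q - 1 ≠ 0 := by linarith
  have hev : ∀ k : ℕ, (2 * q - 1) ^ (2 * k) = (1 - 2 * q) ^ (2 * k) := by
    intro k
    rw [← neg_sub, pow_mul, neg_sq, ← pow_mul]
  have c0 : varianceCoeff q (marginCoeff z) 0
      = (q - 1) * (4 * q ^ 2 - 3 * q - 2) / (2 * q - 1) ^ 4 := by
    rw [hev 2, varianceCoeff, hz]
    simp only [Finset.sum_range_succ, Finset.sum_range_zero, marginCoeff]
    clear hev
    generalize hdd : 1 - 2 * q = d at *
    have hq : q ≠ 0 := hq0.ne'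
    field_simp
    rw [← hdd]
    ring
  have c1 : varianceCoeff q (marginCoeff z) 1
      = -((q - 1) * (4 * q ^ 2 + 2 * q - 7) / (2 * q - 1) ^ 6) := by
    rw [hev 3, varianceCoeff, hz]
    simp only [Finset.sum_range_succ, Finset.sum_range_zero, marginCoeff]
    clear hev
    generalize hdd : 1 - 2 * q = d at *
    have hq : q ≠ 0 := hq0.ne'
    field_simp
    rw [← hdd]
    ring
  have c2 : varianceCoeff q (marginCoeff z) 2
      = -((q - 1) * (24 * q ^ 4 - 12 * q ^ 3 - 58 * q ^ 2 + 29 * q + 18) / (2 * q - 1) ^ 8) := by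
    rw [hev 4, varianceCoeff, hz]
    simp only [Finset.sum_range_succ, Finset.sum_range_zero, marginCoeff]
    clear hev
    generalize hdd : 1 - 2 * q = d at *
    have hq : q ≠ 0 := hq0.ne'
    field_simp
    rw [← hdd]
    ring
  have c3 : varianceCoeff q (marginCoeff z) 3
      = -((q - 1) * (144 * q ^ 6 - 216 * q ^ 5 - 348 * q ^ 4 + 444 * q ^ 3 + 328 * q ^ 2
          - 312 * q - 41) / (2 * q - 1) ^ 10) := by
    rw [hev 5, varianceCoeff, hz]
    simp only [Finset.sum_range_succ, Finset.sum_range_zero, marginCoeff]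
    clear hev
    generalize hdd : 1 - 2 * q = d at *
    have hq : q ≠ 0 := hq0.ne'
    field_simp
    rw [← hdd]
    ring
  have c4 : varianceCoeff q (marginCoeff z) 4
      = -((q - 1) * (864 * q ^ 8 - 2160 * q ^ 7 - 1704 * q ^ 6 + 4956 * q ^ 5 + 4632 * q ^ 4
          - 9972 * q ^ 3 + 1586 * q ^ 2 + 1711 * q + 88) / (2 * q - 1) ^ 12) := by
    rw [hev 6, varianceCoeff, hz]
    simp only [Finset.sum_range_succ, Finset.sum_range_zero, marginCoeff]
    clear hev
    generalize hdd : 1 - 2 * q = d at *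
    have hq : q ≠ 0 := hq0.ne'
    field_simp
    rw [← hdd]
    ring
  rw [varianceOfMargin_marginExpansion q z hn, varianceExpansion, ← c0,
    ← neg_inj.2 c1 |>.trans (neg_neg _), ← neg_inj.2 c2 |>.trans (neg_neg _),
    ← neg_inj.2 c3 |>.trans (neg_neg _), ← neg_inj.2 c4 |>.trans (neg_neg _)]
  simp only [Finset.sum_range_succ, Finset.sum_range_zero]
  generalize varianceCoeff q (marginCoeff z) = v
  ring

lemma varianceFormula_sub_expansion_isBigO {q : ℝ} (hq0 : 0 < q) (hq1 : q < 1 / 2) :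
    (fun n : ℕ => varianceFormula q n - varianceExpansion q n)
      =O[atTop] (fun n : ℕ => 1 / (n : ℝ) ^ 5) := by
  have hd : 0 < 1 - 2 * q := by linarith
  have hp : 0 < 1 - q := by linarith
  obtain ⟨z, hz⟩ : ∃ z, z = 2 * (1 - q) * q / (1 - 2 * q) ^ 2 := ⟨_, rfl⟩
  have hz0 : 0 < z := by rw [hz]; positivity
  have hz' : z * (1 - 2 * q) ^ 2 = 2 * (1 - q) * q := by
    rw [hz, div_mul_cancel₀]; positivity
  have hexp : Continuous (marginExpansion z) := by unfold marginExpansion; fun_prop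
  have hY := normMargin_sub_expansion_isBigO hq0 hq1 hz' hz0
  have hYo : (fun n : ℕ => 1 / (n : ℝ) ^ 6) =O[atTop] (fun _ => (1 : ℝ)) := by
    have h := isBigO_one_of_continuousAt (continuous_pow 6).continuousAt
    exact h.congr_left fun n => by simp
  have hM : (fun n : ℕ => marginExpansion z (1 / n)) =O[atTop] (fun _ => (1 : ℝ)) :=
    isBigO_one_of_continuousAt hexp.continuousAt
  have key : ∀ᶠ n : ℕ in atTop, varianceFormula q n - varianceExpansion q n
      = (normMargin q n - marginExpansion z (1 / n)) * n * (-((1 - q) / (q * (1 - 2 * q) ^ 2)))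
        + (normMargin q n - marginExpansion z (1 / n))
          * ((-((1 - q) / (q * (1 - 2 * q) ^ 2) * ((1 - q) / (1 - 2 * q)))
              + 4 * (1 - q) ^ 2 * q / (1 - 2 * q) ^ 4)
            + -((1 - q) ^ 2 / (1 - 2 * q) ^ 4) * ((normMargin q n - marginExpansion z (1 / n))
              + 2 * marginExpansion z (1 / n)))
        + (1 / (n : ℝ)) ^ 5 * ∑ k ∈ Finset.range 6,
            varianceCoeff q (marginCoeff z) (k + 5) * (1 / (n : ℝ)) ^ k := by
    filter_upwards [eventually_ge_atTop 1] with n hn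
    have hn' : (n : ℝ) ≠ 0 := by positivity
    rw [← varianceOfMargin_sub_expansion hq0 hq1 hz hn', varianceFormula_eq hq0 hq1 hn]
    simp only [varianceOfMargin]
    ring
  have h65 : (fun n : ℕ => 1 / (n : ℝ) ^ 6) =O[atTop] (fun n : ℕ => 1 / (n : ℝ) ^ 5) := by
    refine IsBigO.of_bound 1 ?_
    filter_upwards [eventually_ge_atTop 1] with n hn
    have hn' : (1 : ℝ) ≤ n := by exact_mod_cast hn
    rw [one_mul, Real.norm_of_nonneg (by positivity), Real.norm_of_nonneg (by positivity)]
    exact one_div_le_one_div_of_le (by positivity) (pow_le_pow_right₀ hn' (by norm_num))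
  have hone : ∀ c : ℝ, (fun _ : ℕ => c) =O[atTop] (fun _ => (1 : ℝ)) :=
    fun c => isBigO_const_const c one_ne_zero _
  have h1 : (fun n : ℕ => (normMargin q n - marginExpansion z (1 / n)) * n
      * (-((1 - q) / (q * (1 - 2 * q) ^ 2)))) =O[atTop] (fun n : ℕ => 1 / (n : ℝ) ^ 5) := by
    refine ((hY.mul (isBigO_refl (fun n : ℕ => (n : ℝ)) atTop)).mul (hone _)).congr'
      EventuallyEq.rfl ?_
    filter_upwards [eventually_ge_atTop 1] with n hn
    have hn' : (n : ℝ) ≠ 0 := by positivity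
    field_simp
  have h2 := hY.mul ((hone (-((1 - q) / (q * (1 - 2 * q) ^ 2) * ((1 - q) / (1 - 2 * q)))
              + 4 * (1 - q) ^ 2 * q / (1 - 2 * q) ^ 4)).add
        ((hY.trans hYo).add (hM.const_mul_left 2) |>.const_mul_left
          (-((1 - q) ^ 2 / (1 - 2 * q) ^ 4))))
  simp only [mul_one] at h2
  have h3 : (fun n : ℕ => (1 / (n : ℝ)) ^ 5 * ∑ k ∈ Finset.range 6,
      varianceCoeff q (marginCoeff z) (k + 5) * (1 / (n : ℝ)) ^ k)
      =O[atTop] (fun n : ℕ => 1 / (n : ℝ) ^ 5) := by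
    have := (isBigO_refl (fun n : ℕ => (1 / (n : ℝ)) ^ 5) atTop).mul
      (isBigO_one_of_continuousAt (f := fun h => ∑ k ∈ Finset.range 6,
        varianceCoeff q (marginCoeff z) (k + 5) * h ^ k) (by fun_prop))
    simpa only [mul_one, one_div, inv_pow] using this
  exact EventuallyEq.trans_isBigO key ((h1.add (h2.trans h65)).add h3)

lemma tendsto_varianceExpansion (q : ℝ) :
    Tendsto (fun n : ℕ => varianceExpansion q n) atTop
      (𝓝 ((1 - q) * (2 + 3 * q - 4 * q ^ 2) / (1 - 2 * q) ^ 4)) := by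
  have h : Tendsto (fun n : ℕ => varianceExpansion q (1 / (1 / (n : ℝ)))) atTop
      (𝓝 ((q - 1) * (4 * q ^ 2 - 3 * q - 2) / (2 * q - 1) ^ 4)) := by
    unfold varianceExpansion
    simp only [one_div, inv_inv]
    have hc : ∀ k : ℕ, Tendsto (fun n : ℕ => ((n : ℝ) ^ (k + 1))⁻¹) atTop (𝓝 0) := by
      intro k
      simpa only [one_div, inv_pow, zero_pow k.succ_ne_zero] using
        (tendsto_one_div_atTop_nhds_zero_nat (𝕜 := ℝ)).pow (k + 1)
    have h1 := hc 0
    simp only [zero_add, pow_one] at h1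
    simpa only [mul_zero, sub_zero] using
      ((((tendsto_const_nhds.sub (h1.const_mul _)).sub ((hc 1).const_mul _)).sub
        ((hc 2).const_mul _)).sub ((hc 3).const_mul _))
  simp only [one_div_one_div] at h
  convert h using 2
  rw [← neg_sub (2 * q) 1, Even.neg_pow (by decide)]
  ring

/-! ### Moments of the hitting time of zero -/

/-- The probability that a walk on the integers, started at `d ≥ 0`, which goes down with
probability `q` and up with probability `1 - q`, hits zero for the first time at time `k`. -/
noncomputable def hitProb (q : ℝ) : ℕ → ℕ → ℝ
  | 0, 0 => 1
  | 0, _ + 1 => 0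
  | _ + 1, 0 => 0
  | k + 1, d + 1 => q * hitProb q k d + (1 - q) * hitProb q k (d + 2)

lemma hitProb_nonneg {q : ℝ} (hq0 : 0 ≤ q) (hq1 : q ≤ 1) : ∀ k d, 0 ≤ hitProb q k d
  | 0, 0 => by simp [hitProb]
  | 0, _ + 1 => by simp [hitProb]
  | _ + 1, 0 => by simp [hitProb]
  | k + 1, d + 1 => by
    rw [hitProb]
    exact add_nonneg (mul_nonneg hq0 (hitProb_nonneg hq0 hq1 k d))
      (mul_nonneg (by linarith) (hitProb_nonneg hq0 hq1 k (d + 2)))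

/-- A nonnegative function harmonic for the walk that vanishes at zero and at infinity is zero. -/
lemma harmonic_eq_zero {q : ℝ} (hq0 : 0 < q) (hq1 : q < 1) {u : ℕ → ℝ} (h0 : u 0 = 0)
    (hnn : ∀ d, 0 ≤ u d) (hu : ∀ d, u (d + 1) = q * u d + (1 - q) * u (d + 2))
    (hlim : Tendsto u atTop (𝓝 0)) (d : ℕ) : u d = 0 := by
  have hmono : Monotone u := by
    refine monotone_nat_of_le_succ fun n => ?_
    induction n with
    | zero => rw [h0]; exact hnn _
    | succ n ih =>
      have h : (1 - q) * (u (n + 2) - u (n + 1)) = q * (u (n + 1) - u n) := by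
        linear_combination -hu n
      have h' : 0 ≤ (1 - q) * (u (n + 2) - u (n + 1)) := by
        rw [h]; exact mul_nonneg hq0.le (by linarith)
      linarith [nonneg_of_mul_nonneg_right h' (by linarith : 0 < 1 - q)]
  exact le_antisymm (hmono.ge_of_tendsto hlim d) (hnn d)

/-- If `u k d` evolves by the first-step recursion of the walk with a source `s`, then its sums over
time are given by the solution of the Poisson equation that vanishes at infinity. -/
lemma hasSum_of_poisson {q : ℝ} (hq0 : 0 < q) (hq1 : q < 1) {u s : ℕ → ℕ → ℝ} {f σ : ℕ → ℝ}
    (hu : ∀ k d, 0 ≤ u k d) (hu0 : HasSum (fun k => u k 0) (f 0)) (hu1 : ∀ d, u 0 (d + 1) = 0)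
    (hrec : ∀ k d, u (k + 1) (d + 1) = q * u k d + (1 - q) * u k (d + 2) + s k (d + 1))
    (hs : ∀ k d, 0 ≤ s k d) (hσ : ∀ d, HasSum (fun k => s k (d + 1)) (σ (d + 1)))
    (hf : ∀ d, 0 ≤ f d) (hfrec : ∀ d, f (d + 1) = q * f d + (1 - q) * f (d + 2) + σ (d + 1))
    (hlim : Tendsto f atTop (𝓝 0)) (d : ℕ) : HasSum (fun k => u k d) (f d) := by
  have hp : 0 < 1 - q := by linarith
  have hle : ∀ N d, ∑ k ∈ Finset.range N, u k d ≤ f d := by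
    intro N
    induction N with
    | zero => intro d; simpa using hf d
    | succ N ih =>
      intro d
      rcases d with _ | d
      · exact sum_le_hasSum _ (fun k _ => hu k 0) hu0
      · rw [Finset.sum_range_succ', hu1, add_zero]
        simp only [hrec, Finset.sum_add_distrib, ← Finset.mul_sum]
        rw [hfrec]
        exact add_le_add (add_le_add (mul_le_mul_of_nonneg_left (ih _) hq0.le)
          (mul_le_mul_of_nonneg_left (ih _) hp.le))
          (sum_le_hasSum _ (fun k _ => hs k _) (hσ d))
  have hsum : ∀ d, Summable (fun k => u k d) := fun d =>
    summable_of_sum_range_le (fun k => hu k d) (fun N => hle N d)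
  have hLle : ∀ d, ∑' k, u k d ≤ f d := fun d =>
    Real.tsum_le_of_sum_range_le (fun k => hu k d) (fun N => hle N d)
  have hL0 : ∀ d, 0 ≤ ∑' k, u k d := fun d => tsum_nonneg fun k => hu k d
  have hLrec : ∀ d, ∑' k, u k (d + 1)
      = q * ∑' k, u k d + (1 - q) * ∑' k, u k (d + 2) + σ (d + 1) := by
    intro d
    rw [(hsum (d + 1)).tsum_eq_zero_add, hu1, zero_add]
    simp only [hrec]
    exact ((((hsum d).hasSum.mul_left q).add ((hsum (d + 2)).hasSum.mul_left (1 - q))).add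
      (hσ d)).tsum_eq
  have hdiff := harmonic_eq_zero hq0 hq1 (u := fun d => f d - ∑' k, u k d)
    (by rw [hu0.tsum_eq, sub_self]) (fun d => sub_nonneg.2 (hLle d))
    (fun d => by rw [hfrec, hLrec]; ring)
    (squeeze_zero (fun d => sub_nonneg.2 (hLle d)) (fun d => by linarith [hL0 d]) hlim) d
  rw [sub_eq_zero.1 hdiff]
  exact (hsum d).hasSum

/-- The contribution of the start `d` to the `i`-th moment of the hitting time of zero,
for `i ≤ 2`. -/
noncomputable def hitMoment (q : ℝ) (i d : ℕ) : ℝ :=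
  (q / (1 - q)) ^ d * match i with
    | 0 => 1
    | 1 => (d : ℝ) / (1 - 2 * q)
    | _ => (d : ℝ) ^ 2 / (1 - 2 * q) ^ 2 + 4 * (1 - q) * q / (1 - 2 * q) ^ 3 * d

lemma tendsto_pow_mul_hitRatio {q : ℝ} (hq0 : 0 < q) (hq1 : q < 1 / 2) (i : ℕ) :
    Tendsto (fun d : ℕ => (d : ℝ) ^ i * (q / (1 - q)) ^ d) atTop (𝓝 0) := by
  have hp : 0 < 1 - q := by linarith
  refine tendsto_pow_const_mul_const_pow_of_abs_lt_one i ?_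
  rw [abs_of_pos (by positivity), div_lt_one hp]
  linarith

lemma hitRatio_rec {q : ℝ} (hq1 : q < 1) (d : ℕ) :
    (1 - q) * (q / (1 - q)) ^ (d + 1) = q * (q / (1 - q)) ^ d := by
  have hp : 1 - q ≠ 0 := by linarith
  rw [pow_succ]; field_simp

lemma hasSum_hitProb {q : ℝ} (hq0 : 0 < q) (hq1 : q < 1 / 2) (d : ℕ) :
    HasSum (fun k => hitProb q k d) (hitMoment q 0 d) := by
  have hp : 0 < 1 - q := by linarith
  refine hasSum_of_poisson hq0 (by linarith) (s := fun _ _ => 0) (σ := fun _ => 0)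
    (hitProb_nonneg hq0.le (by linarith)) ?_ (fun d => by simp [hitProb])
    (fun k d => by simp [hitProb]) (fun _ _ => le_rfl) (fun d => hasSum_zero)
    (fun d => by simp only [hitMoment]; positivity) (fun d => ?_) ?_ d
  · have : hitMoment q 0 0 = hitProb q 0 0 := by simp [hitMoment, hitProb]
    rw [this]
    refine hasSum_single 0 fun k hk => ?_
    obtain ⟨m, rfl⟩ := Nat.exists_eq_succ_of_ne_zero hk
    simp [hitProb]
  · have h1 := hitRatio_rec (by linarith : q < 1) d
    have h2 := hitRatio_rec (by linarith : q < 1) (d + 1)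
    simp only [hitMoment]
    linear_combination h1 - h2
  · refine (tendsto_pow_mul_hitRatio hq0 hq1 0).congr fun d => ?_
    simp [hitMoment]

lemma hasSum_mul_hitProb {q : ℝ} (hq0 : 0 < q) (hq1 : q < 1 / 2) (d : ℕ) :
    HasSum (fun k : ℕ => (k : ℝ) * hitProb q k d) (hitMoment q 1 d) := by
  have hp : 0 < 1 - q := by linarith
  have hd : 0 < 1 - 2 * q := by linarith
  have hnn := hitProb_nonneg hq0.le (by linarith : q ≤ 1)
  refine hasSum_of_poisson hq0 (by linarith) (s := fun k d => hitProb q (k + 1) d)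
    (σ := hitMoment q 0)
    (fun k d => mul_nonneg k.cast_nonneg (hnn k d)) ?_ (fun d => by simp)
    (fun k d => by simp only [hitProb]; push_cast; ring) (fun _ _ => hnn _ _) (fun d => ?_)
    (fun d => by simp only [hitMoment]; positivity) (fun d => ?_) ?_ d
  · have : ∀ k : ℕ, (k : ℝ) * hitProb q k 0 = 0 := by
      rintro (_ | k) <;> simp [hitProb]
    simp [this, hitMoment, hasSum_zero]
  · simpa [hitProb] using (hasSum_nat_add_iff' 1).2 (hasSum_hitProb hq0 hq1 (d + 1))
  · simp only [hitMoment, pow_succ (q / (1 - q))]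
    generalize (q / (1 - q)) ^ d = x
    push_cast
    obtain ⟨e, he⟩ : ∃ e, 1 - 2 * q = e := ⟨_, rfl⟩
    obtain ⟨p, hpe⟩ : ∃ p, 1 - q = p := ⟨_, rfl⟩
    rw [he] at hd ⊢
    rw [hpe] at hp ⊢
    field_simp
    rw [← he, ← hpe]
    ring
  · have := (tendsto_pow_mul_hitRatio hq0 hq1 1).div_const (1 - 2 * q)
    simp only [zero_div, pow_one] at this
    refine this.congr fun d => ?_
    simp only [hitMoment]
    ring

lemma hasSum_sq_mul_hitProb {q : ℝ} (hq0 : 0 < q) (hq1 : q < 1 / 2) (d : ℕ) :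
    HasSum (fun k : ℕ => (k : ℝ) ^ 2 * hitProb q k d) (hitMoment q 2 d) := by
  have hp : 0 < 1 - q := by linarith
  have hd : 0 < 1 - 2 * q := by linarith
  have hnn := hitProb_nonneg hq0.le (by linarith : q ≤ 1)
  refine hasSum_of_poisson hq0 (by linarith)
    (s := fun k d => (2 * ((k + 1 : ℕ) : ℝ) - 1) * hitProb q (k + 1) d)
    (σ := fun d => 2 * hitMoment q 1 d - hitMoment q 0 d)
    (fun k d => mul_nonneg (by positivity) (hnn k d)) ?_ (fun d => by simp)
    (fun k d => by simp only [hitProb]; push_cast; ring)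
    (fun k _ => mul_nonneg (by push_cast; linarith [k.cast_nonneg (α := ℝ)]) (hnn _ _))
    (fun d => ?_)
    (fun d => by simp only [hitMoment]; positivity) (fun d => ?_) ?_ d
  · have : ∀ k : ℕ, (k : ℝ) ^ 2 * hitProb q k 0 = 0 := by
      rintro (_ | k) <;> simp [hitProb]
    simp [this, hitMoment, hasSum_zero]
  · have := (hasSum_nat_add_iff' 1).2
      (((hasSum_mul_hitProb hq0 hq1 (d + 1)).mul_left 2).sub (hasSum_hitProb hq0 hq1 (d + 1)))
    simp only [Finset.sum_range_one, hitProb, mul_zero, sub_zero] at this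
    refine this.congr_fun fun k => ?_
    simp only [hitProb]
    ring
  · simp only [hitMoment, pow_succ (q / (1 - q))]
    generalize (q / (1 - q)) ^ d = x
    push_cast
    obtain ⟨e, he⟩ : ∃ e, 1 - 2 * q = e := ⟨_, rfl⟩
    obtain ⟨p, hpe⟩ : ∃ p, 1 - q = p := ⟨_, rfl⟩
    rw [he] at hd ⊢
    rw [hpe] at hp ⊢
    field_simp
    rw [← he, ← hpe]
    ring
  · have := ((tendsto_pow_mul_hitRatio hq0 hq1 2).div_const ((1 - 2 * q) ^ 2)).add
      ((tendsto_pow_mul_hitRatio hq0 hq1 1).const_mul (4 * (1 - q) * q / (1 - 2 * q) ^ 3))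
    simp only [zero_div, mul_zero, add_zero, pow_one] at this
    refine this.congr fun d => ?_
    simp only [hitMoment]
    ring

/-! ### The law of the length of Phase I and of the duration of Phase II -/

section FirstStep

variable {Ω : Type*} [MeasurableSpace Ω] {μ : Measure Ω} {q : ℝ} {X : ℕ → Ω → Bool}

lemma IsMatch.shift (hX : IsMatch μ q X) : IsMatch μ q (fun i => X (i + 1)) where
  measurable i := hX.measurable (i + 1)
  indep := hX.indep.precomp (add_left_injective 1)
  prob i := hX.prob (i + 1)

lemma IsMatch.measurable_history (hX : IsMatch μ q X) : Measurable fun ω i => X i ω :=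
  measurable_pi_iff.2 hX.measurable

lemma IsMatch.prob_false [IsProbabilityMeasure μ] (hX : IsMatch μ q X) (i : ℕ) :
    μ.real {ω | X i ω = false} = 1 - q := by
  have h : {ω | X i ω = false} = {ω | X i ω = true}ᶜ := by ext; simp
  have hm : MeasurableSet {ω | X i ω = true} := hX.measurable i (measurableSet_singleton true)
  rw [h, probReal_compl_eq_one_sub hm, hX.prob]

lemma IsMatch.indepFun_zero_shift (hX : IsMatch μ q X) :
    IndepFun (X 0) (fun ω i => X (i + 1) ω) μ := by
  have h := indep_iSup_of_disjoint (fun i => (hX.measurable i).comap_le) hX.indep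
    (S := {0}) (T := {i | i ≠ 0}) (by simp)
  refine indep_of_indep_of_le_left (indep_of_indep_of_le_right h ?_) ?_
  · simp only [MeasurableSpace.pi, MeasurableSpace.comap_iSup, MeasurableSpace.comap_comp]
    exact iSup_le fun i => le_iSup₂_of_le (i + 1) (by simp) le_rfl
  · exact le_iSup₂_of_le 0 rfl le_rfl

/-- First-step decomposition: conditioning on the first goal. -/
lemma IsMatch.first_step [IsProbabilityMeasure μ] (hX : IsMatch μ q X) {E F : Set (ℕ → Bool)}
    (hE : MeasurableSet E) (hF : MeasurableSet F) :
    μ.real {ω | (X 0 ω = true ∧ (fun i => X (i + 1) ω) ∈ E)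
        ∨ (X 0 ω = false ∧ (fun i => X (i + 1) ω) ∈ F)}
      = q * μ.real {ω | (fun i => X (i + 1) ω) ∈ E}
        + (1 - q) * μ.real {ω | (fun i => X (i + 1) ω) ∈ F} := by
  have hind := hX.indepFun_zero_shift
  have hm := hX.shift.measurable_history
  have h : ∀ (b : Bool) {A : Set (ℕ → Bool)}, MeasurableSet A →
      μ.real {ω | X 0 ω = b ∧ (fun i => X (i + 1) ω) ∈ A}
        = μ.real {ω | X 0 ω = b} * μ.real {ω | (fun i => X (i + 1) ω) ∈ A} := by
    intro b A hA
    have := hind.measure_inter_preimage_eq_mul {b} A (measurableSet_singleton b) hA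
    simp only [measureReal_def, ← ENNReal.toReal_mul]
    exact congrArg ENNReal.toReal this
  have h1 := h true hE
  have h2 := h false hF
  rw [hX.prob] at h1
  rw [hX.prob_false] at h2
  rw [← h1, ← h2, ← measureReal_union]
  · rfl
  · rw [Set.disjoint_left]
    rintro ω ⟨h1, -⟩ ⟨h2, -⟩
    simp [h1] at h2
  · exact (hX.measurable 0 (measurableSet_singleton false)).inter (hm hF)

end FirstStep

/-- The lead of team G after `t` goals. -/
def lead (x : ℕ → Bool) (t : ℕ) : ℤ := (goalsG x t : ℤ) - goalsB x t

/-- Phase I, which requires `g` goals of team G, lasts `L` goals, and if team G started it with a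
lead of `s` goals, then Phase II lasts `k` goals. -/
def Phases (g : ℕ) (s : ℤ) (L k : ℕ) : Set (ℕ → Bool) :=
  {x | goalsG x L = g ∧ (∀ t < L, goalsG x t ≠ g) ∧ s + lead x (L + k) ≤ 0 ∧
    ∀ l < k, 0 < s + lead x (L + l)}

lemma goalsG_zero (x : ℕ → Bool) : goalsG x 0 = 0 := Nat.count_zero _

lemma lead_zero (x : ℕ → Bool) : lead x 0 = 0 := by simp [lead, goalsG, goalsB]

lemma goalsG_succ' (x : ℕ → Bool) (t : ℕ) :
    goalsG x (t + 1) = goalsG (fun i => x (i + 1)) t + if x 0 = false then 1 else 0 :=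
  Nat.count_succ' _ _

lemma goalsB_succ' (x : ℕ → Bool) (t : ℕ) :
    goalsB x (t + 1) = goalsB (fun i => x (i + 1)) t + if x 0 = true then 1 else 0 :=
  Nat.count_succ' _ _

lemma lead_succ_of_true {x : ℕ → Bool} (h : x 0 = true) (t : ℕ) :
    lead x (t + 1) = lead (fun i => x (i + 1)) t - 1 := by
  rw [lead, lead, goalsG_succ', goalsB_succ', h]
  push_cast
  simp
  ring

lemma lead_succ_of_false {x : ℕ → Bool} (h : x 0 = false) (t : ℕ) :
    lead x (t + 1) = lead (fun i => x (i + 1)) t + 1 := by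
  rw [lead, lead, goalsG_succ', goalsB_succ', h]
  push_cast
  simp
  ring

lemma measurable_goalsG (t : ℕ) : Measurable fun x : ℕ → Bool => goalsG x t := by
  unfold goalsG
  simp only [Nat.count_eq_card_filter_range, Finset.card_filter]
  refine Finset.measurable_sum _ fun i _ => ?_
  exact (measurable_of_countable fun b : Bool => if b = false then 1 else 0).comp
    (measurable_pi_apply i)

lemma measurable_goalsB (t : ℕ) : Measurable fun x : ℕ → Bool => goalsB x t := by
  unfold goalsB
  simp only [Nat.count_eq_card_filter_range, Finset.card_filter]
  refine Finset.measurable_sum _ fun i _ => ?_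
  exact (measurable_of_countable fun b : Bool => if b = true then 1 else 0).comp
    (measurable_pi_apply i)

lemma measurable_lead (t : ℕ) : Measurable fun x : ℕ → Bool => lead x t :=
  (measurable_of_countable fun p : ℕ × ℕ => (p.1 : ℤ) - p.2).comp
    ((measurable_goalsG t).prodMk (measurable_goalsB t))

lemma measurableSet_phases (g : ℕ) (s : ℤ) (L k : ℕ) : MeasurableSet (Phases g s L k) := by
  have hG : ∀ t, MeasurableSet {x : ℕ → Bool | goalsG x t = g} := fun t =>
    measurable_goalsG t (measurableSet_singleton g)
  have hl : ∀ t, MeasurableSet {x : ℕ → Bool | s + lead x t ≤ 0} := fun t =>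
    measurable_lead t (MeasurableSet.of_discrete (s := {y : ℤ | s + y ≤ 0}))
  have hl' : ∀ t, MeasurableSet {x : ℕ → Bool | 0 < s + lead x t} := fun t =>
    measurable_lead t (MeasurableSet.of_discrete (s := {y : ℤ | 0 < s + y}))
  have h1 : MeasurableSet {x : ℕ → Bool | ∀ t < L, goalsG x t ≠ g} := by
    simp only [Set.ofPred_forall]
    exact MeasurableSet.iInter fun t => MeasurableSet.iInter fun _ => (hG t).compl
  have h2 : MeasurableSet {x : ℕ → Bool | ∀ l < k, 0 < s + lead x (L + l)} := by
    simp only [Set.ofPred_forall]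
    exact MeasurableSet.iInter fun t => MeasurableSet.iInter fun _ => hl' _
  exact (hG L).inter (h1.inter ((hl _).inter h2))

lemma forall_lt_succ_iff_zero {P : ℕ → Prop} {n : ℕ} :
    (∀ t < n + 1, P t) ↔ P 0 ∧ ∀ t < n, P (t + 1) := by
  constructor
  · exact fun h => ⟨h 0 n.succ_pos, fun t ht => h (t + 1) (by omega)⟩
  · rintro ⟨h0, h⟩ (_ | t) ht
    · exact h0
    · exact h t (by omega)

lemma mem_phases_succ (g : ℕ) (s : ℤ) (L k : ℕ) (x : ℕ → Bool) :
    x ∈ Phases (g + 1) s (L + 1) k ↔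
      (x 0 = true ∧ (fun i => x (i + 1)) ∈ Phases (g + 1) (s - 1) L k) ∨
      (x 0 = false ∧ (fun i => x (i + 1)) ∈ Phases g (s + 1) L k) := by
  simp only [Phases, Set.mem_ofPred_eq, forall_lt_succ_iff_zero, goalsG_zero, goalsG_succ',
    Nat.add_right_comm L 1]
  have e : ∀ a : ℤ, s + (a + 1) = s + 1 + a := fun a => by ring
  cases h : x 0
  · simp [lead_succ_of_false h, e]
  · simp [lead_succ_of_true h, sub_add_eq_add_sub, add_sub_assoc]

lemma mem_phases_zero_succ (s : ℤ) (k : ℕ) (x : ℕ → Bool) :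
    x ∈ Phases 0 s 0 (k + 1) ↔ 0 < s ∧
      ((x 0 = true ∧ (fun i => x (i + 1)) ∈ Phases 0 (s - 1) 0 k) ∨
      (x 0 = false ∧ (fun i => x (i + 1)) ∈ Phases 0 (s + 1) 0 k)) := by
  simp only [Phases, Set.mem_ofPred_eq, forall_lt_succ_iff_zero, goalsG_zero, lead_zero,
    zero_add]
  cases h : x 0
  · simp [lead_succ_of_false h, add_assoc, add_comm (1 : ℤ)]
    tauto
  · simp [lead_succ_of_true h, sub_add_eq_add_sub, add_sub_assoc]
    tauto

/-- The probability that Phase I, which requires `g` goals of team G, lasts `L` goals. -/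
noncomputable def phaseOneProb (q : ℝ) : ℕ → ℕ → ℝ
  | 0, 0 => 1
  | 0, _ + 1 => 0
  | _ + 1, 0 => 0
  | g + 1, L + 1 => q * phaseOneProb q (g + 1) L + (1 - q) * phaseOneProb q g L

lemma phaseOneProb_succ (q : ℝ) (g L : ℕ) :
    phaseOneProb q (g + 1) (L + 1) = (L.choose g : ℝ) * (1 - q) ^ (g + 1) * q ^ (L - g) := by
  induction L generalizing g with
  | zero => rcases g with _ | g <;> simp [phaseOneProb]
  | succ L ih =>
    rw [phaseOneProb, ih]
    rcases g with _ | g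
    · simp [phaseOneProb, pow_succ]; ring
    · rw [ih, Nat.choose_succ_succ, Nat.succ_sub_succ]
      rcases le_or_gt (g + 1) L with h | h
      · rw [show L - g = (L - (g + 1)) + 1 by omega]
        push_cast
        ring
      · rw [Nat.choose_eq_zero_of_lt h]
        push_cast
        ring

lemma measureReal_phases_zero {Ω : Type*} [MeasurableSpace Ω] {μ : Measure Ω}
    [IsProbabilityMeasure μ] {q : ℝ} (k : ℕ) : ∀ {X : ℕ → Ω → Bool}, IsMatch μ q X → ∀ s : ℤ,
    μ.real {ω | (fun i => X i ω) ∈ Phases 0 s 0 k} = hitProb q k s.toNat := by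
  induction k with
  | zero =>
    intro X hX s
    rcases le_or_gt s 0 with hs | hs
    · simp [Phases, goalsG_zero, lead_zero, hs, Int.toNat_of_nonpos hs, hitProb]
    · obtain ⟨d, rfl⟩ : ∃ d : ℕ, s = d + 1 := ⟨(s - 1).toNat, by omega⟩
      simp [Phases, goalsG_zero, lead_zero, hitProb,
        show ((d : ℤ) + 1).toNat = d + 1 by omega, show ¬ ((d : ℤ) + 1 ≤ 0) by omega]
  | succ k ih =>
    intro X hX s
    simp only [mem_phases_zero_succ]
    rcases le_or_gt s 0 with hs | hs
    · simp [hs.not_gt, Int.toNat_of_nonpos hs, hitProb]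
    · simp only [hs, true_and]
      rw [hX.first_step (measurableSet_phases _ _ _ _) (measurableSet_phases _ _ _ _),
        ih hX.shift, ih hX.shift]
      obtain ⟨d, rfl⟩ : ∃ d : ℕ, s = d + 1 := ⟨(s - 1).toNat, by omega⟩
      rw [show ((d : ℤ) + 1 - 1).toNat = d by omega, show ((d : ℤ) + 1 + 1).toNat = d + 2 by omega,
        show ((d : ℤ) + 1).toNat = d + 1 by omega, hitProb]

/-- The joint law of the length of Phase I and the duration of Phase II. -/
lemma measureReal_phases {Ω : Type*} [MeasurableSpace Ω] {μ : Measure Ω}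
    [IsProbabilityMeasure μ] {q : ℝ} (k L : ℕ) : ∀ {X : ℕ → Ω → Bool}, IsMatch μ q X →
    ∀ (g : ℕ) (s : ℤ), μ.real {ω | (fun i => X i ω) ∈ Phases g s L k}
      = phaseOneProb q g L * hitProb q k (s + 2 * g - L).toNat := by
  induction L with
  | zero =>
    rintro X hX (_ | g) s
    · simpa [phaseOneProb] using measureReal_phases_zero k hX s
    · simp [phaseOneProb, Phases, goalsG_zero]
  | succ L ih =>
    rintro X hX (_ | g) s
    · have : ∀ x, x ∉ Phases 0 s (L + 1) k := fun x hx => hx.2.1 0 L.succ_pos (goalsG_zero x)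
      simp [phaseOneProb, this]
    · simp only [mem_phases_succ]
      rw [hX.first_step (measurableSet_phases _ _ _ _) (measurableSet_phases _ _ _ _),
        ih hX.shift, ih hX.shift, phaseOneProb]
      push_cast
      rw [show s - 1 + 2 * ((g : ℤ) + 1) - L = s + 2 * (g + 1) - (L + 1) by ring,
        show s + 1 + 2 * (g : ℤ) - L = s + 2 * (g + 1) - (L + 1) by ring]
      ring

lemma phases_iff {n L k : ℕ} {x : ℕ → Bool} :
    x ∈ Phases n 0 L k ↔ TeamBWins n x ∧ phaseOneLength n x = L ∧ phaseTwoDuration n x = k := by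
  have hc : ∀ k, CaughtUpAfter n x k ↔ (0 : ℤ) + lead x (phaseOneLength n x + k) ≤ 0 := by
    intro k
    rw [CaughtUpAfter, lead]
    omega
  constructor
  · rintro ⟨h1, h2, h3, h4⟩
    have hL : phaseOneLength n x = L :=
      le_antisymm (Nat.sInf_le h1) (le_csInf ⟨L, h1⟩ fun t ht => not_lt.1 fun h => h2 t h ht)
    have hk : CaughtUpAfter n x k := by rw [hc, hL]; exact h3
    refine ⟨⟨⟨L, h1⟩, k, hk⟩, hL,
      le_antisymm (Nat.sInf_le hk) (le_csInf ⟨k, hk⟩ fun l hl => not_lt.1 fun h => ?_)⟩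
    have h5 := h4 l h
    have h6 := (hc l).1 hl
    rw [hL] at h6
    omega
  · rintro ⟨⟨h1, h2⟩, rfl, rfl⟩
    refine ⟨Nat.sInf_mem h1, fun t ht h => Nat.notMem_of_lt_sInf ht h, (hc _).1 (Nat.sInf_mem h2),
      fun l hl => ?_⟩
    have := Nat.notMem_of_lt_sInf hl
    rw [Set.mem_ofPred_eq, hc] at this
    omega

/-! ### The conditional moments of the duration of Phase II -/

lemma hitMoment_nonneg {q : ℝ} (hq0 : 0 < q) (hq1 : q < 1 / 2) (i d : ℕ) : 0 ≤ hitMoment q i d := by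
  have hp : 0 < 1 - q := by linarith
  have hd : 0 < 1 - 2 * q := by linarith
  unfold hitMoment
  split <;> positivity

lemma hasSum_pow_mul_hitProb {q : ℝ} (hq0 : 0 < q) (hq1 : q < 1 / 2) {i : ℕ} (hi : i ≤ 2) (d : ℕ) :
    HasSum (fun k : ℕ => (k : ℝ) ^ i * hitProb q k d) (hitMoment q i d) := by
  interval_cases i
  · simpa using hasSum_hitProb hq0 hq1 d
  · simpa using hasSum_mul_hitProb hq0 hq1 d
  · exact hasSum_sq_mul_hitProb hq0 hq1 d

lemma hasSum_negBinTerm {q : ℝ} (hq0 : 0 < q) (hq1 : q < 1) {n : ℕ} (hn : 1 ≤ n) :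
    HasSum (negBinTerm (1 - q) q n) 1 := by
  obtain ⟨m, rfl⟩ : ∃ m, n = m + 1 := ⟨n - 1, by omega⟩
  have hp : 1 - q ≠ 0 := by linarith
  have h := (hasSum_choose_mul_geometric_of_norm_lt_one (𝕜 := ℝ) m (r := q)
    (by rwa [Real.norm_of_nonneg hq0.le])).mul_left ((1 - q) ^ (m + 1))
  rw [mul_one_div_cancel (pow_ne_zero _ hp)] at h
  refine h.congr_fun fun j => ?_
  rw [negBinTerm, Nat.add_sub_cancel, Nat.add_comm m j, ← Nat.choose_symm_add (a := j)]
  ring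

lemma negBinTerm_mul_hitRatio {q : ℝ} (hq1 : q < 1) {n j : ℕ} (hj : j ≤ n) :
    negBinTerm (1 - q) q n j * (q / (1 - q)) ^ (n - j) = negBinTerm q (1 - q) n j := by
  have hp : 1 - q ≠ 0 := by linarith
  obtain ⟨d, rfl⟩ := Nat.exists_eq_add_of_le hj
  rw [Nat.add_sub_cancel_left, negBinTerm, negBinTerm, div_pow, pow_add, pow_add]
  field_simp

/-- The `i`-th moment of the duration of Phase II on the event that team B wins, for `i ≤ 2`. -/
noncomputable def winMoment (q : ℝ) (i n : ℕ) : ℝ :=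
  match i with
  | 0 => 2 * raceProb q (1 - q) n n
  | 1 => marginMoment q (1 - q) 1 n / (1 - 2 * q)
  | _ => marginMoment q (1 - q) 2 n / (1 - 2 * q) ^ 2
      + 4 * (1 - q) * q / (1 - 2 * q) ^ 3 * marginMoment q (1 - q) 1 n

lemma hitMoment_two (q : ℝ) (d : ℕ) : hitMoment q 2 d = (q / (1 - q)) ^ d
    * ((d : ℝ) ^ 2 / (1 - 2 * q) ^ 2 + 4 * (1 - q) * q / (1 - 2 * q) ^ 3 * d) := rfl

lemma winMoment_two (q : ℝ) (n : ℕ) : winMoment q 2 n = marginMoment q (1 - q) 2 n / (1 - 2 * q) ^ 2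
    + 4 * (1 - q) * q / (1 - 2 * q) ^ 3 * marginMoment q (1 - q) 1 n := rfl

lemma hasSum_negBinTerm_mul_hitMoment {q : ℝ} (hq0 : 0 < q) (hq1 : q < 1 / 2) {i : ℕ} (hi : i ≤ 2)
    {n : ℕ} (hn : 1 ≤ n) :
    HasSum (fun j => negBinTerm (1 - q) q n j * hitMoment q i (n - j)) (winMoment q i n) := by
  have hle : ∀ {j}, j ∈ Finset.range n → j ≤ n := fun hj => (Finset.mem_range.1 hj).le
  have hfin : i ≠ 0 → HasSum (fun j => negBinTerm (1 - q) q n j * hitMoment q i (n - j))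
      (∑ j ∈ Finset.range n, negBinTerm (1 - q) q n j * hitMoment q i (n - j)) := by
    intro hi0
    refine hasSum_sum_of_ne_finset_zero fun j hj => ?_
    rw [Finset.mem_range, not_lt] at hj
    rw [Nat.sub_eq_zero_of_le hj]
    interval_cases i <;> simp [hitMoment] at hi0 ⊢
  interval_cases i
  · have h1 := hasSum_negBinTerm hq0 (by linarith) hn
    have h2 : HasSum (fun j => negBinTerm (1 - q) q n j * (hitMoment q 0 (n - j) - 1))
        (∑ j ∈ Finset.range n, negBinTerm (1 - q) q n j * (hitMoment q 0 (n - j) - 1)) := by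
      refine hasSum_sum_of_ne_finset_zero fun j hj => ?_
      rw [Finset.mem_range, not_lt] at hj
      simp [Nat.sub_eq_zero_of_le hj, hitMoment]
    have h3 : 1 + ∑ j ∈ Finset.range n, negBinTerm (1 - q) q n j * (hitMoment q 0 (n - j) - 1)
        = winMoment q 0 n := by
      have h4 : ∑ j ∈ Finset.range n, negBinTerm (1 - q) q n j * (hitMoment q 0 (n - j) - 1)
          = raceProb q (1 - q) n n - raceProb (1 - q) q n n := by
        rw [raceProb, raceProb, ← Finset.sum_sub_distrib]
        refine Finset.sum_congr rfl fun j hj => ?_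
        rw [← negBinTerm_mul_hitRatio (by linarith) (hle hj), hitMoment]
        ring
      rw [h4, winMoment]
      linear_combination -raceProb_add_raceProb q hn
    rw [← h3]
    exact (h1.add h2).congr_fun fun j => by ring
  · convert hfin one_ne_zero using 1
    rw [winMoment, marginMoment, Finset.sum_div]
    refine Finset.sum_congr rfl fun j hj => ?_
    rw [← negBinTerm_mul_hitRatio (by linarith) (hle hj), hitMoment, Nat.cast_sub (hle hj)]
    ring
  · convert hfin two_ne_zero using 1
    rw [winMoment_two, marginMoment, marginMoment, Finset.sum_div, Finset.mul_sum,
      ← Finset.sum_add_distrib]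
    refine Finset.sum_congr rfl fun j hj => ?_
    rw [← negBinTerm_mul_hitRatio (by linarith) (hle hj), hitMoment_two, Nat.cast_sub (hle hj)]
    ring

lemma phaseOneProb_nonneg {q : ℝ} (hq0 : 0 ≤ q) (hq1 : q ≤ 1) {n : ℕ} (hn : 1 ≤ n) (L : ℕ) :
    0 ≤ phaseOneProb q n L := by
  obtain ⟨m, rfl⟩ : ∃ m, n = m + 1 := ⟨n - 1, by omega⟩
  rcases L with _ | L
  · simp [phaseOneProb]
  · rw [phaseOneProb_succ]
    have : 0 ≤ 1 - q := by linarith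
    positivity

lemma hasSum_phaseOneProb_mul_hitMoment {q : ℝ} (hq0 : 0 < q) (hq1 : q < 1 / 2) {i : ℕ}
    (hi : i ≤ 2) {n : ℕ} (hn : 1 ≤ n) :
    HasSum (fun L : ℕ => phaseOneProb q n L * hitMoment q i (0 + 2 * (n : ℤ) - L).toNat)
      (winMoment q i n) := by
  have h0 : ∀ L < n, phaseOneProb q n L = 0 := by
    intro L hL
    obtain ⟨m, rfl⟩ : ∃ m, n = m + 1 := ⟨n - 1, by omega⟩
    rcases L with _ | L
    · simp [phaseOneProb]
    · rw [phaseOneProb_succ, Nat.choose_eq_zero_of_lt (by omega)]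
      simp
  rw [← hasSum_nat_add_iff' n, Finset.sum_eq_zero, sub_zero]
  · refine (hasSum_negBinTerm_mul_hitMoment hq0 hq1 hi hn).congr_fun fun j => ?_
    rw [show (0 + 2 * (n : ℤ) - ((j + n : ℕ) : ℤ)).toNat = n - j by omega]
    obtain ⟨m, rfl⟩ : ∃ m, n = m + 1 := ⟨n - 1, by omega⟩
    rw [← add_assoc, phaseOneProb_succ, negBinTerm, Nat.add_sub_cancel, Nat.add_sub_cancel,
      Nat.add_comm m j, Nat.choose_symm_add]
  · intro L hL
    rw [h0 L (Finset.mem_range.1 hL), zero_mul]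

lemma winEvent_eq_iUnion {Ω : Type*} (X : ℕ → Ω → Bool) (n : ℕ) :
    winEvent X n = ⋃ p : ℕ × ℕ, {ω | (fun i => X i ω) ∈ Phases n 0 p.1 p.2} := by
  ext ω
  simp [winEvent, phases_iff]

lemma pairwise_disjoint_phases {Ω : Type*} (X : ℕ → Ω → Bool) (n : ℕ) :
    Pairwise (Function.onFun Disjoint
      fun p : ℕ × ℕ => {ω | (fun i => X i ω) ∈ Phases n 0 p.1 p.2}) := by
  intro a b hab
  rw [Function.onFun, Set.disjoint_left]
  intro ω h1 h2
  rw [Set.mem_ofPred_eq, phases_iff] at h1 h2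
  exact hab (Prod.ext (h1.2.1.symm.trans h2.2.1) (h1.2.2.symm.trans h2.2.2))

lemma duration_eq_of_mem {Ω : Type*} {X : ℕ → Ω → Bool} {n L k : ℕ} {ω : Ω}
    (h : (fun i => X i ω) ∈ Phases n 0 L k) :
    duration X n ω = k := by
  rw [duration, (phases_iff.1 h).2.2]

lemma duration_nonneg {Ω : Type*} (X : ℕ → Ω → Bool) (n : ℕ) (ω : Ω) :
    0 ≤ duration X n ω := Nat.cast_nonneg _

lemma winMoment_nonneg {q : ℝ} (hq0 : 0 < q) (hq1 : q < 1 / 2) {i : ℕ} (hi : i ≤ 2)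
    {n : ℕ} (hn : 1 ≤ n) :
    0 ≤ winMoment q i n :=
  (hasSum_phaseOneProb_mul_hitMoment hq0 hq1 hi hn).nonneg fun L =>
    mul_nonneg (phaseOneProb_nonneg hq0.le (by linarith) hn L) (hitMoment_nonneg hq0 hq1 _ _)

section Moments

variable {Ω : Type*} [MeasurableSpace Ω] {μ : Measure Ω} {q : ℝ} {X : ℕ → Ω → Bool}

lemma IsMatch.measurableSet_phases (hX : IsMatch μ q X) (n L k : ℕ) :
    MeasurableSet {ω | (fun i => X i ω) ∈ Phases n 0 L k} :=
  hX.measurable_history (SoccerMatch.measurableSet_phases n 0 L k)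

lemma IsMatch.measurableSet_winEvent (hX : IsMatch μ q X) (n : ℕ) :
    MeasurableSet (winEvent X n) := by
  rw [winEvent_eq_iUnion]
  exact MeasurableSet.iUnion fun p => hX.measurableSet_phases n p.1 p.2

lemma IsMatch.aemeasurable_duration (hX : IsMatch μ q X) (n : ℕ) :
    AEMeasurable (duration X n) (μ.restrict (winEvent X n)) := by
  rw [winEvent_eq_iUnion, aemeasurable_iUnion_iff]
  intro p
  refine (aemeasurable_const (b := (p.2 : ℝ))).congr ?_
  filter_upwards [ae_restrict_mem (hX.measurableSet_phases n p.1 p.2)] with ω hω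
  exact (duration_eq_of_mem hω).symm

lemma IsMatch.lintegral_duration_pow [IsProbabilityMeasure μ] (hq0 : 0 < q) (hq1 : q < 1 / 2)
    (hX : IsMatch μ q X) {i : ℕ} (hi : i ≤ 2) {n : ℕ} (hn : 1 ≤ n) :
    ∫⁻ ω in winEvent X n, ENNReal.ofReal (duration X n ω ^ i) ∂μ
      = ENNReal.ofReal (winMoment q i n) := by
  have hph := phaseOneProb_nonneg hq0.le (by linarith : q ≤ 1) hn
  have hh := hitProb_nonneg hq0.le (by linarith : q ≤ 1)
  rw [winEvent_eq_iUnion, lintegral_iUnion (fun p : ℕ × ℕ => hX.measurableSet_phases n p.1 p.2)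
    (pairwise_disjoint_phases X n), ENNReal.tsum_prod']
  have h1 : ∀ L k : ℕ, ∫⁻ ω in {ω | (fun i => X i ω) ∈ Phases n 0 L k},
      ENNReal.ofReal (duration X n ω ^ i) ∂μ
      = ENNReal.ofReal (phaseOneProb q n L
        * ((k : ℝ) ^ i * hitProb q k (0 + 2 * (n : ℤ) - L).toNat)) := by
    intro L k
    rw [setLIntegral_congr_fun (g := fun _ => ENNReal.ofReal ((k : ℝ) ^ i))
      (hX.measurableSet_phases n L k) (fun ω hω => by rw [duration_eq_of_mem hω]),
      setLIntegral_const, ← ofReal_measureReal, measureReal_phases k L hX n 0,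
      ← ENNReal.ofReal_mul (by positivity)]
    congr 1
    ring
  have h2 : ∀ L : ℕ, ∑' k : ℕ, ENNReal.ofReal (phaseOneProb q n L
        * ((k : ℝ) ^ i * hitProb q k (0 + 2 * (n : ℤ) - L).toNat))
      = ENNReal.ofReal (phaseOneProb q n L * hitMoment q i (0 + 2 * (n : ℤ) - L).toNat) := by
    intro L
    have h := (hasSum_pow_mul_hitProb hq0 hq1 hi (0 + 2 * (n : ℤ) - L).toNat).mul_left
      (phaseOneProb q n L)
    rw [← h.tsum_eq, ENNReal.ofReal_tsum_of_nonneg _ h.summable]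
    exact fun k => mul_nonneg (hph L) (mul_nonneg (by positivity) (hh _ _))
  simp only [h1, h2]
  have h := hasSum_phaseOneProb_mul_hitMoment hq0 hq1 hi hn
  rw [← h.tsum_eq, ENNReal.ofReal_tsum_of_nonneg _ h.summable]
  exact fun L => mul_nonneg (hph L) (hitMoment_nonneg hq0 hq1 _ _)

lemma IsMatch.measure_winEvent [IsProbabilityMeasure μ] (hq0 : 0 < q) (hq1 : q < 1 / 2)
    (hX : IsMatch μ q X) {n : ℕ} (hn : 1 ≤ n) :
    μ (winEvent X n) = ENNReal.ofReal (2 * raceProb q (1 - q) n n) := by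
  have h := hX.lintegral_duration_pow hq0 hq1 (Nat.zero_le 2) hn
  simpa [winMoment] using h

lemma IsMatch.measure_winEvent_pos [IsProbabilityMeasure μ] (hq0 : 0 < q) (hq1 : q < 1 / 2)
    (hX : IsMatch μ q X) {n : ℕ} (hn : 1 ≤ n) : 0 < μ (winEvent X n) := by
  rw [hX.measure_winEvent hq0 hq1 hn, ENNReal.ofReal_pos]
  linarith [raceProb_pos hq0 (by linarith : 0 < 1 - q) (n := n) hn]

lemma IsMatch.memLp_duration [IsProbabilityMeasure μ] (hq0 : 0 < q) (hq1 : q < 1 / 2)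
    (hX : IsMatch μ q X) {n : ℕ} (hn : 1 ≤ n) :
    MemLp (duration X n) 2 (ProbabilityTheory.cond μ (winEvent X n)) := by
  have hm := hX.aemeasurable_duration n
  refine MemLp.smul_measure ?_ (ENNReal.inv_ne_top.2 (hX.measure_winEvent_pos hq0 hq1 hn).ne')
  rw [memLp_two_iff_integrable_sq hm.aestronglyMeasurable]
  refine ⟨(hm.pow_const 2).aestronglyMeasurable, ?_⟩
  rw [hasFiniteIntegral_iff_ofReal (Eventually.of_forall fun ω => sq_nonneg _),
    hX.lintegral_duration_pow hq0 hq1 le_rfl hn]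
  exact ENNReal.ofReal_lt_top

lemma IsMatch.integral_cond_duration_pow [IsProbabilityMeasure μ] (hq0 : 0 < q) (hq1 : q < 1 / 2)
    (hX : IsMatch μ q X) {i : ℕ} (hi : i ≤ 2) {n : ℕ} (hn : 1 ≤ n) :
    ∫ ω, duration X n ω ^ i ∂(ProbabilityTheory.cond μ (winEvent X n))
      = winMoment q i n / (2 * raceProb q (1 - q) n n) := by
  have hT := raceProb_pos hq0 (by linarith : 0 < 1 - q) (n := n) hn
  rw [ProbabilityTheory.cond, integral_smul_measure, integral_eq_lintegral_of_nonneg_ae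
    (Eventually.of_forall fun ω => pow_nonneg (duration_nonneg X n ω) i)
    ((hX.aemeasurable_duration n).pow_const i).aestronglyMeasurable,
    hX.lintegral_duration_pow hq0 hq1 hi hn, hX.measure_winEvent hq0 hq1 hn,
    ENNReal.toReal_inv, ENNReal.toReal_ofReal (by positivity),
    ENNReal.toReal_ofReal (winMoment_nonneg hq0 hq1 hi hn), smul_eq_mul]
  ring

lemma IsMatch.condVarDuration_eq [IsProbabilityMeasure μ] (hq0 : 0 < q) (hq1 : q < 1 / 2)
    (hX : IsMatch μ q X) {n : ℕ} (hn : 1 ≤ n) :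
    condVarDuration μ X n = varianceFormula q n := by
  have : IsProbabilityMeasure (ProbabilityTheory.cond μ (winEvent X n)) :=
    cond_isProbabilityMeasure (hX.measure_winEvent_pos hq0 hq1 hn).ne'
  have h1 := hX.integral_cond_duration_pow hq0 hq1 one_le_two hn
  have h2 := hX.integral_cond_duration_pow hq0 hq1 le_rfl hn
  simp only [pow_one] at h1
  rw [condVarDuration, variance_eq_sub (hX.memLp_duration hq0 hq1 hn)]
  simp only [Pi.pow_apply]
  rw [h1, h2]
  rfl

end Moments

end SoccerMatch

theorem theorem6 {Ω : Type*} [MeasurableSpace Ω] (μ : Measure Ω) [IsProbabilityMeasure μ]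
    (q : ℝ) (hq0 : 0 < q) (hq1 : q < 1 / 2)
    (X : ℕ → Ω → Bool) (hX : SoccerMatch.IsMatch μ q X) :
    (∀ n : ℕ, 1 ≤ n →
      MeasurableSet (SoccerMatch.winEvent X n) ∧
      0 < μ (SoccerMatch.winEvent X n) ∧
      MemLp (SoccerMatch.duration X n) 2
        (ProbabilityTheory.cond μ (SoccerMatch.winEvent X n))) ∧
    Tendsto (fun n : ℕ => SoccerMatch.condVarDuration μ X n) atTop
      (𝓝 ((1 - q) * (2 + 3 * q - 4 * q ^ 2) / (1 - 2 * q) ^ 4)) ∧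
    (fun n : ℕ => SoccerMatch.condVarDuration μ X n -
      ((q - 1) * (4 * q ^ 2 - 3 * q - 2) / (2 * q - 1) ^ 4
        - (q - 1) * (4 * q ^ 2 + 2 * q - 7) / (2 * q - 1) ^ 6 * (1 / (n : ℝ))
        - (q - 1) * (24 * q ^ 4 - 12 * q ^ 3 - 58 * q ^ 2 + 29 * q + 18) / (2 * q - 1) ^ 8
            * (1 / (n : ℝ) ^ 2)
        - (q - 1) * (144 * q ^ 6 - 216 * q ^ 5 - 348 * q ^ 4 + 444 * q ^ 3 + 328 * q ^ 2
              - 312 * q - 41) / (2 * q - 1) ^ 10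
            * (1 / (n : ℝ) ^ 3)
        - (q - 1) * (864 * q ^ 8 - 2160 * q ^ 7 - 1704 * q ^ 6 + 4956 * q ^ 5 + 4632 * q ^ 4
              - 9972 * q ^ 3 + 1586 * q ^ 2 + 1711 * q + 88) / (2 * q - 1) ^ 12
            * (1 / (n : ℝ) ^ 4)))
      =O[atTop] (fun n : ℕ => 1 / (n : ℝ) ^ 5) := by
  have hO : (fun n : ℕ => SoccerMatch.condVarDuration μ X n - SoccerMatch.varianceExpansion q n)
      =O[atTop] (fun n : ℕ => 1 / (n : ℝ) ^ 5) := by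
    refine (SoccerMatch.varianceFormula_sub_expansion_isBigO hq0 hq1).congr' ?_ EventuallyEq.rfl
    filter_upwards [eventually_ge_atTop 1] with n hn
    rw [hX.condVarDuration_eq hq0 hq1 hn]
  refine ⟨fun n hn => ⟨hX.measurableSet_winEvent n, hX.measure_winEvent_pos hq0 hq1 hn,
    hX.memLp_duration hq0 hq1 hn⟩, ?_, hO⟩
  have h0 : Tendsto (fun n : ℕ => 1 / (n : ℝ) ^ 5) atTop (𝓝 0) := by
    have h := (tendsto_one_div_atTop_nhds_zero_nat (𝕜 := ℝ)).pow 5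
    simpa only [one_div_pow, zero_pow (Nat.succ_ne_zero 4)] using h
  have h := (hO.trans_tendsto h0).add (SoccerMatch.tendsto_varianceExpansion q)
  rw [zero_add] at h
  exact h.congr fun n => sub_add_cancel _ _
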